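/- Let $n\ge 2$, let $\mathbb B^n$ be the open unit ball of $\mathbb R^n$, $\sigma_{k}=2\pi^{(k+1)/2}/\Gamma((k+1)/2)$ for $k\ge 1$, and $\sigma_0=0$ by convention. For a compact set $K$ contained in an open set $O\subseteq\mathbb R^n$, let $\mathrm{ncap}(O,K)=\inf_u\int_{\mathbb R^n}|\nabla u|^n\,dV$, the infimum being over all continuous $u:\mathbb R^n\to[0,1]$ that are absolutely continuous on almost all lines parallel to the coordinate axes, vanish on $K$, and for which the closure of $\{u<1\}$ is a compact subset of $O$. Put $\mathrm{nmod}(O,K)=\big(\mathrm{ncap}(O,K)/\sigma_{n-1}\big)^{1/(1-n)}$ and $$\mathrm{ncap}_1(K)=\exp\Big(-\lim_{r\to\infty}\big(\mathrm{nmod}(r\mathbb B^n,K)-\ln r\big)\Big).$$ Let $$\mathrm{nrob}(K)=\inf_\mu\int\!\!\int\ln\frac1{|x-y|}\,d\mu(x)\,d\mu(y),\qquad \mathrm{ncap}_3(K)=\exp(-\mathrm{nrob}(K)),$$ the infimum being over all Borel probability measures $\mu$ carried by $K$, and let $$\mathrm{nmd}(O,K)=\inf_{\nu}\int\!\!\int\ln\frac1{|x-y|}\,d\nu(x)\,d\nu(y),$$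 the infimum being over all signed measures $\nu=\nu_K-\nu_O$, with $\nu_K$ and $\nu_O$ Borel probability measures carried by $K$ and by $\mathbb R^n\setminus O$ respectively, for which the integral is defined. Values and limits are taken in $[-\infty,\infty]$, with $\inf\emptyset=+\infty$ and $\exp(-\infty)=0$. (i) For every compact $K\subset\mathbb R^n$ the limit $\lim_{r\to\infty}\big(\mathrm{nmd}(r\mathbb B^n,K)-\ln r\big)$ exists in $[-\infty,\infty]$ and $$\mathrm{ncap}_3(K)=\frac{\exp\Big(-\lim_{r\to\infty}\big(\mathrm{nmd}(r\mathbb B^n,K)-\ln r\big)\Big)}{\mathrm{ncap}_3(\overline{\mathbb B^n})}.$$ (ii) For every $r>0$ the limit defining $\mathrm{ncap}_1(r\overline{\mathbb B^n})$ exists, and $$\mathrm{ncap}_1(r\overline{\mathbb B^n})=r,\qquad \mathrm{ncap}_3(r\overline{\mathbb B^n})=r\exp\left(\frac{\sigma_{n-2}}{2\sigma_{n-1}}\int_0^\pi(\sin\theta)^{n-2}\ln\big(2(1-\cos\theta)\big)\,d\theta\right).$$ Moreover $\mathrm{ncap}_1(r\overline{\mathbb B^n})=\mathrm{ncap}_3(r\overline{\mathbb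 B^n})$ if and only if $n=2$. -/

import Mathlib

open MeasureTheory Filter Topology
open scoped ENNReal

namespace ConformalCapacity

noncomputable section

/-- `σ_k`: the surface area `2 π^{(k+1)/2} / Γ((k+1)/2)` of the unit sphere of `ℝ^{k+1}` for `k ≥ 1`,
with the convention `σ_0 = 0`. -/
def sphereArea (k : ℕ) : ℝ :=
  if k = 0 then 0
  else 2 * Real.pi ^ (((k : ℝ) + 1) / 2) / Real.Gamma (((k : ℝ) + 1) / 2)

/-! ### Conformal capacity of a condenser, conformal modulus, and the first capacity -/

/-- The point of `ℝⁿ` with `i`-th coordinate `t` and remaining coordinates `y`; for fixed `y` this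
runs through a line parallel to the `i`-th coordinate axis. -/
def linePoint {n : ℕ} (i : Fin n) (y : {j : Fin n // j ≠ i} → ℝ) (t : ℝ) :
    EuclideanSpace ℝ (Fin n) :=
  WithLp.toLp 2 fun j => if h : j = i then t else y ⟨j, h⟩

/-- `u` is absolutely continuous on lines: for each coordinate direction, on almost every line with
that direction (for the `(n-1)`-dimensional Lebesgue measure on the lines), `u` is absolutely
continuous on every compact segment of the line. -/
def IsACL {n : ℕ} (u : EuclideanSpace ℝ (Fin n) → ℝ) : Prop :=
  ∀ i : Fin n, ∀ᵐ y : ({j : Fin n // j ≠ i} → ℝ), ∀ a b : ℝ,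
    AbsolutelyContinuousOnInterval (fun t => u (linePoint i y t)) a b

/-- `|∇u(x)|`, through the partial derivatives of `u` (which exist almost everywhere when `u` is
absolutely continuous on lines). -/
def gradNorm {n : ℕ} (u : EuclideanSpace ℝ (Fin n) → ℝ) (x : EuclideanSpace ℝ (Fin n)) : ℝ :=
  Real.sqrt (∑ i : Fin n, (lineDeriv ℝ u x (EuclideanSpace.single i 1)) ^ 2)

/-- The class `W(O, K)` of admissible functions for the condenser `(O, K)`. -/
structure IsAdmissible {n : ℕ} (O K : Set (EuclideanSpace ℝ (Fin n)))
    (u : EuclideanSpace ℝ (Fin n) → ℝ) : Prop where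
  continuous : Continuous u
  acl : IsACL u
  nonneg : ∀ x, 0 ≤ u x
  le_one : ∀ x, u x ≤ 1
  eq_zero : ∀ x ∈ K, u x = 0
  isCompact_closure : IsCompact (closure {x | 0 ≤ u x ∧ u x < 1})
  closure_subset : closure {x | 0 ≤ u x ∧ u x < 1} ⊆ O

/-- The conformal capacity of the condenser `(O, K)`: the infimum of `∫ |∇u|ⁿ dV`, `u ∈ W(O, K)`. -/
def condCap {n : ℕ} (O K : Set (EuclideanSpace ℝ (Fin n))) : ℝ≥0∞ :=
  ⨅ (u : EuclideanSpace ℝ (Fin n) → ℝ) (_ : IsAdmissible O K u),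
    ∫⁻ x, ENNReal.ofReal (gradNorm u x ^ n)

/-- The conformal modulus `nmod(O, K) = (ncap(O, K) / σ_{n-1})^{1/(1-n)}`, in `[0, ∞]`. -/
def nmod {n : ℕ} (O K : Set (EuclideanSpace ℝ (Fin n))) : ℝ≥0∞ :=
  (condCap O K / ENNReal.ofReal (sphereArea (n - 1))) ^ (1 / (1 - (n : ℝ)))

/-- `nmod(rBⁿ, K) - ln r`. -/
def reducedMod {n : ℕ} (K : Set (EuclideanSpace ℝ (Fin n))) (r : ℝ) : EReal :=
  (nmod (Metric.ball 0 r) K : EReal) - (Real.log r : EReal)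

/-- `ncap₁(K) = exp (- lim_{r → ∞} (nmod(rBⁿ, K) - ln r))`. -/
def ncap1 {n : ℕ} (K : Set (EuclideanSpace ℝ (Fin n))) : ℝ≥0∞ :=
  EReal.exp (-(limUnder atTop (reducedMod K)))

/-! ### Logarithmic energy, the third capacity and the transfinite modulus -/

/-- The kernel `ln (1 / |x - y|)`, equal to `+∞` when `x = y`. -/
def logKernel {n : ℕ} (x y : EuclideanSpace ℝ (Fin n)) : EReal :=
  ENNReal.log (edist x y)⁻¹

/-- The double integral of the positive part of `ln (1 / |x - y|)` against `μ ⊗ ν`. -/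
def posEnergy {n : ℕ} (μ ν : Measure (EuclideanSpace ℝ (Fin n))) : ℝ≥0∞ :=
  ∫⁻ x, ∫⁻ y, (logKernel x y).toENNReal ∂ν ∂μ

/-- The double integral of the negative part of `ln (1 / |x - y|)` against `μ ⊗ ν`. -/
def negEnergy {n : ℕ} (μ ν : Measure (EuclideanSpace ℝ (Fin n))) : ℝ≥0∞ :=
  ∫⁻ x, ∫⁻ y, (-logKernel x y).toENNReal ∂ν ∂μ

/-- The logarithmic Robin mass: the infimum of `∬ ln (1 / |x - y|) dμ(x) dμ(y)` over the unit
measures `μ` carried by `K`. For compact `K` the negative part of the integrand is bounded, so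
that the integral is well defined in `(-∞, ∞]`. -/
def nrob {n : ℕ} (K : Set (EuclideanSpace ℝ (Fin n))) : EReal :=
  ⨅ (μ : Measure (EuclideanSpace ℝ (Fin n))) (_ : IsProbabilityMeasure μ) (_ : μ Kᶜ = 0),
    (posEnergy μ μ : EReal) - (negEnergy μ μ : EReal)

/-- `ncap₃(K) = exp (- nrob(K))`. -/
def ncap3 {n : ℕ} (K : Set (EuclideanSpace ℝ (Fin n))) : ℝ≥0∞ :=
  EReal.exp (-nrob K)

/-- The integral of the positive part of `ln (1 / |x - y|)` with respect to `ν ⊗ ν`, where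
`ν = νK - νO` and `νK`, `νO` are mutually singular. -/
def signedPos {n : ℕ} (νK νO : Measure (EuclideanSpace ℝ (Fin n))) : ℝ≥0∞ :=
  posEnergy νK νK + posEnergy νO νO + negEnergy νK νO + negEnergy νO νK

/-- The negative counterpart: the integral of `ln (1 / |x - y|)` with respect to `ν ⊗ ν` is
`signedPos νK νO - signedNeg νK νO`, whenever at least one of the two is finite. -/
def signedNeg {n : ℕ} (νK νO : Measure (EuclideanSpace ℝ (Fin n))) : ℝ≥0∞ :=
  negEnergy νK νK + negEnergy νO νO + posEnergy νK νO + posEnergy νO νK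

/-- The class of charges `ν = νK - νO` of the condenser `(O, K)`: `νK` and `νO` are unit measures
carried by the two plates `K` and `ℝⁿ \ O`, and the energy integral of `ν` has a meaning. -/
structure IsCharge {n : ℕ} (O K : Set (EuclideanSpace ℝ (Fin n)))
    (νK νO : Measure (EuclideanSpace ℝ (Fin n))) : Prop where
  prob_inner : IsProbabilityMeasure νK
  prob_outer : IsProbabilityMeasure νO
  carried_inner : νK Kᶜ = 0
  carried_outer : νO O = 0
  defined : signedPos νK νO ≠ ⊤ ∨ signedNeg νK νO ≠ ⊤

/-- The transfinite modulus `nmd(O, K)`: the infimum of `∬ ln (1 / |x - y|) dν(x) dν(y)`. -/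
def nmd {n : ℕ} (O K : Set (EuclideanSpace ℝ (Fin n))) : EReal :=
  ⨅ (νK : Measure (EuclideanSpace ℝ (Fin n))) (νO : Measure (EuclideanSpace ℝ (Fin n)))
    (_ : IsCharge O K νK νO),
    (signedPos νK νO : EReal) - (signedNeg νK νO : EReal)

end

end ConformalCapacity

/-! Write n = m + 2, let β = `ballRobin m` be the logarithmic energy of the uniform measure on the
unit sphere, and write I(·,·) for mutual logarithmic energy.

Part (i). Let K lie in the ball of radius ρ, and let νK − νO be a charge of the condenser (rB, K).
Its energy is I(νK) + I(νO) − 2 I(νK, νO). Seen from the outer plate, K looks like a point at the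
origin: −2 I(νK, νO) equals 2 ∫ ln|y| dνO up to 2δ, where δ = −ln(1 − ρ/r) → 0. Inversion satisfies
|y* − z*| = |y − z| / (|y||z|), so I(νO) + 2 ∫ ln|y| dνO is the energy of the inverted measure. That
measure is carried by the ball of radius 1/r, so its energy is at least β + ln r, and the uniform
measure on |y| = r gives this value. Hence nmd(rB, K) − ln r tends to nrob(K) + β
(`le_charge_energy`, `nmd_le_logEnergy_add`), and exp(−β) is `ncap3` of the unit ball.

Energy of balls. That β is the minimum for the unit ball (`le_shiftedEnergy_unitBall`) rests on two
facts. The logarithmic kernel is positive definite on differences of probability measures, being a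
superposition of Gaussians, each a convolution square. The potential of the sphere measure inside
the ball, a log-sine integral in |x|, is smallest on the sphere (`logSineIntegral_le_one`). The
latter follows from the vanishing of the integral with m = 0 (Jensen) and a common sign change. The
same argument gives β < 0 for m > 0 and β = 0 for m = 0, which is the equality criterion in (ii).

Conformal capacity of a spherical ring. The field x · max(|x|, r)^{-n} has its divergence inside the
inner ball, where admissible functions vanish. Integration by parts along lines gives the same flux
σ_{n-1} for every admissible u, and Hölder's inequality turns this into the sharp lower bound.
Logarithmic functions of |x| attain it in the limit (`condCap_ring`), so `ncap1` of the ball is its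
radius. -/

namespace ConformalCapacity

open Set

/-! ### Spherical coordinates for functions of the norm and one coordinate -/

section Slicing

/-- Polar coordinates for a radial nonnegative function. -/
theorem lintegral_fun_norm {E : Type*} [NormedAddCommGroup E] [NormedSpace ℝ E] [MeasurableSpace E]
    [BorelSpace E] [FiniteDimensional ℝ E] [Nontrivial E] (μ : Measure E) [μ.IsAddHaarMeasure]
    {f : ℝ → ℝ≥0∞} (hf : Measurable f) :
    ∫⁻ x, f ‖x‖ ∂μ = Module.finrank ℝ E * μ (Metric.ball 0 1) *
      ∫⁻ y in Ioi (0 : ℝ), ENNReal.ofReal (y ^ (Module.finrank ℝ E - 1)) * f y := by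
  calc
    ∫⁻ x, f ‖x‖ ∂μ = ∫⁻ x : ({(0)}ᶜ : Set E), f ‖x.1‖ ∂(μ.comap (↑)) := by
      rw [lintegral_subtype_comap (measurableSet_singleton _).compl fun x ↦ f ‖x‖,
        restrict_compl_singleton]
    _ = ∫⁻ x, f x.2 ∂μ.toSphere.prod (.volumeIoiPow (Module.finrank ℝ E - 1)) := by
      simpa using μ.measurePreserving_homeomorphUnitSphereProd.lintegral_comp_emb
        (Homeomorph.measurableEmbedding _) (f ∘ Subtype.val ∘ Prod.snd)
    _ = μ.toSphere univ *
        ∫⁻ x : Ioi (0 : ℝ), f x ∂.volumeIoiPow (Module.finrank ℝ E - 1) := by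
      rw [lintegral_prod _ (by fun_prop)]
      simp [mul_comm]
    _ = _ := by
      rw [μ.toSphere_apply_univ, Measure.volumeIoiPow,
        lintegral_withDensity_eq_lintegral_mul _ (by fun_prop) (by fun_prop)]
      congr 1
      exact lintegral_subtype_comap measurableSet_Ioi
        (fun y : ℝ => ENNReal.ofReal (y ^ (Module.finrank ℝ E - 1)) * f y)

theorem lintegral_norm_coord_zero (m : ℕ) {F : ℝ → ℝ → ℝ≥0∞}
    (hF : Measurable (Function.uncurry F)) :
    ∫⁻ x : EuclideanSpace ℝ (Fin (m + 1)), F ‖x‖ (x 0) =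
      ∫⁻ t : ℝ, ∫⁻ z : EuclideanSpace ℝ (Fin m), F (√(t ^ 2 + ‖z‖ ^ 2)) t := by
  have h1 := (EuclideanSpace.volume_preserving_symm_measurableEquiv_toLp
    (Fin (m + 1))).symm.lintegral_comp_emb (MeasurableEquiv.measurableEmbedding _)
      (fun x : EuclideanSpace ℝ (Fin (m + 1)) => F ‖x‖ (x 0))
  have h2 := (volume_preserving_piFinSuccAbove (fun _ : Fin (m + 1) => ℝ) 0).symm.lintegral_comp_emb
    (MeasurableEquiv.measurableEmbedding _)
    (fun x : Fin (m + 1) → ℝ => F ‖WithLp.toLp 2 x‖ (x 0))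
  have key : ∀ (t : ℝ) (z : Fin m → ℝ),
      ‖WithLp.toLp 2 (Fin.cons t z : Fin (m + 1) → ℝ)‖
        = √(t ^ 2 + ‖(WithLp.toLp 2 z : EuclideanSpace ℝ (Fin m))‖ ^ 2) := by
    intro t z
    rw [EuclideanSpace.norm_eq, EuclideanSpace.norm_eq, Real.sq_sqrt (by positivity)]
    simp [Fin.sum_univ_succ]
  have h3 : ∀ t : ℝ, ∫⁻ z : Fin m → ℝ,
        F (√(t ^ 2 + ‖(WithLp.toLp 2 z : EuclideanSpace ℝ (Fin m))‖ ^ 2)) t =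
      ∫⁻ z : EuclideanSpace ℝ (Fin m), F (√(t ^ 2 + ‖z‖ ^ 2)) t := fun t =>
    (EuclideanSpace.volume_preserving_symm_measurableEquiv_toLp
      (Fin m)).symm.lintegral_comp_emb (MeasurableEquiv.measurableEmbedding _)
        (fun z : EuclideanSpace ℝ (Fin m) => F (√(t ^ 2 + ‖z‖ ^ 2)) t)
  have e : ∀ a : ℝ × (Fin m → ℝ),
      (MeasurableEquiv.piFinSuccAbove (fun _ : Fin (m + 1) => ℝ) 0).symm a =
        (Fin.cons a.1 a.2 : Fin (m + 1) → ℝ) := fun a => by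
    simp; rfl
  simp only [e, key, Fin.cons_zero] at h2
  rw [← h1]
  refine h2.symm.trans ?_
  rw [Measure.volume_eq_prod, lintegral_prod]
  · exact lintegral_congr h3
  · exact (hF.comp (by fun_prop : Measurable fun p : ℝ × (Fin m → ℝ) =>
      (√(p.1 ^ 2 + ‖(WithLp.toLp 2 p.2 : EuclideanSpace ℝ (Fin m))‖ ^ 2), p.1))).aemeasurable

/-- Spherical coordinates for a function of the norm and of the first coordinate. -/
theorem lintegral_norm_coord_zero_eq_polar (m : ℕ) {F : ℝ → ℝ → ℝ≥0∞}
    (hF : Measurable (Function.uncurry F)) :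
    ∫⁻ x : EuclideanSpace ℝ (Fin (m + 2)), F ‖x‖ (x 0) =
      (m + 1) * volume (Metric.ball (0 : EuclideanSpace ℝ (Fin (m + 1))) 1) *
        ∫⁻ s in Ioi (0 : ℝ), ∫⁻ θ in Ioo 0 Real.pi,
          ENNReal.ofReal s * (ENNReal.ofReal ((s * Real.sin θ) ^ m) * F s (s * Real.cos θ)) := by
  -- Extended by zero to τ ≤ 0, so that polar coordinates of the whole plane apply; only angles in
  -- (0, π) then contribute.
  set G : ℝ × ℝ → ℝ≥0∞ := fun p => (Ioi (0 : ℝ)).indicator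
    (fun τ => ENNReal.ofReal (τ ^ m) * F (√(p.1 ^ 2 + τ ^ 2)) p.1) p.2 with hG
  have hFm : Measurable fun p : ℝ × ℝ =>
      ENNReal.ofReal (p.2 ^ m) * F (√(p.1 ^ 2 + p.2 ^ 2)) p.1 :=
    (by fun_prop : Measurable fun p : ℝ × ℝ => ENNReal.ofReal (p.2 ^ m)).mul
      (hF.comp (by fun_prop : Measurable fun p : ℝ × ℝ => (√(p.1 ^ 2 + p.2 ^ 2), p.1)))
  have hGm : Measurable G := by
    have : G = (Prod.snd ⁻¹' Ioi (0 : ℝ)).indicator fun p : ℝ × ℝ =>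
      ENNReal.ofReal (p.2 ^ m) * F (√(p.1 ^ 2 + p.2 ^ 2)) p.1 := by
      ext p; simp [hG, indicator]
    rw [this]
    exact hFm.indicator (measurable_snd measurableSet_Ioi)
  have hrad : ∀ t : ℝ, ∫⁻ z : EuclideanSpace ℝ (Fin (m + 1)), F (√(t ^ 2 + ‖z‖ ^ 2)) t =
      (m + 1) * volume (Metric.ball (0 : EuclideanSpace ℝ (Fin (m + 1))) 1) *
        ∫⁻ τ, G (t, τ) := by
    intro t
    rw [lintegral_fun_norm volume (f := fun τ => F (√(t ^ 2 + τ ^ 2)) t)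
      (hF.comp (by fun_prop : Measurable fun τ : ℝ => (√(t ^ 2 + τ ^ 2), t)))]
    simp [hG, lintegral_indicator measurableSet_Ioi]
  rw [lintegral_norm_coord_zero _ hF, lintegral_congr hrad, lintegral_const_mul _
    (Measurable.lintegral_prod_right hGm), ← lintegral_prod _ hGm.aemeasurable,
    ← Measure.volume_eq_prod, ← lintegral_comp_polarCoord_symm, polarCoord_target,
    Measure.volume_eq_prod, ← Measure.prod_restrict, lintegral_prod]
  · congr 1
    refine setLIntegral_congr_fun measurableSet_Ioi fun s hs => ?_
    have hs : 0 < s := hs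
    have hsub : Ioo 0 Real.pi ⊆ Ioo (-Real.pi) Real.pi := Ioo_subset_Ioo_left (by linarith [Real.pi_pos])
    have hind : ∀ θ ∈ Ioo (-Real.pi) Real.pi,
        ENNReal.ofReal s • G (polarCoord.symm (s, θ)) = (Ioo 0 Real.pi).indicator (fun θ =>
          ENNReal.ofReal s * (ENNReal.ofReal ((s * Real.sin θ) ^ m) * F s (s * Real.cos θ))) θ := by
      intro θ hθ
      have hsq : √((s * Real.cos θ) ^ 2 + (s * Real.sin θ) ^ 2) = s := by
        rw [show (s * Real.cos θ) ^ 2 + (s * Real.sin θ) ^ 2 = s ^ 2 by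
          nlinarith [Real.sin_sq_add_cos_sq θ], Real.sqrt_sq hs.le]
      rcases le_or_gt θ 0 with h | h
      · have : ¬ (0 < s * Real.sin θ) := by
          have := Real.sin_nonpos_of_nonpos_of_neg_pi_le h hθ.1.le
          nlinarith
        simp [hG, indicator, this, h.not_gt]
      · have h2 : 0 < s * Real.sin θ := mul_pos hs (Real.sin_pos_of_pos_of_lt_pi h hθ.2)
        simp [hG, indicator, h2, h, hθ.2, hsq]
    rw [setLIntegral_congr_fun measurableSet_Ioo hind, setLIntegral_indicator measurableSet_Ioo,
      inter_eq_left.2 hsub]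
  · refine Measurable.aemeasurable ?_
    simp only [smul_eq_mul]
    exact (by fun_prop : Measurable fun p : ℝ × ℝ => ENNReal.ofReal p.1).mul
      (hGm.comp continuous_polarCoord_symm.measurable)

end Slicing

/-! ### The uniform measure on the unit sphere and the law of one coordinate -/

section UnitSphereMeasure

/-- The uniform probability measure on the unit sphere: the normalized volume of the unit ball
pushed forward by the radial projection. -/
noncomputable def unitSphereMeasure (n : ℕ) : Measure (EuclideanSpace ℝ (Fin n)) :=
  (volume (Metric.ball (0 : EuclideanSpace ℝ (Fin n)) 1))⁻¹ •
    (volume.restrict (Metric.ball (0 : EuclideanSpace ℝ (Fin n)) 1)).map fun x => ‖x‖⁻¹ • x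

theorem measurable_radialProjection (n : ℕ) :
    Measurable fun x : EuclideanSpace ℝ (Fin n) => ‖x‖⁻¹ • x := by fun_prop

theorem volume_unitBall_ne_zero (n : ℕ) :
    volume (Metric.ball (0 : EuclideanSpace ℝ (Fin n)) 1) ≠ 0 :=
  (Metric.measure_ball_pos _ _ one_pos).ne'

theorem volume_unitBall_ne_top (n : ℕ) :
    volume (Metric.ball (0 : EuclideanSpace ℝ (Fin n)) 1) ≠ ⊤ :=
  measure_ball_lt_top.ne

theorem lintegral_unitSphereMeasure (n : ℕ) {f : EuclideanSpace ℝ (Fin n) → ℝ≥0∞}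
    (hf : Measurable f) :
    ∫⁻ y, f y ∂unitSphereMeasure n =
      (volume (Metric.ball (0 : EuclideanSpace ℝ (Fin n)) 1))⁻¹ *
        ∫⁻ x in Metric.ball (0 : EuclideanSpace ℝ (Fin n)) 1, f (‖x‖⁻¹ • x) := by
  rw [unitSphereMeasure, lintegral_smul_measure, lintegral_map hf (measurable_radialProjection n),
    smul_eq_mul]

instance (n : ℕ) : IsProbabilityMeasure (unitSphereMeasure n) where
  measure_univ := by
    rw [unitSphereMeasure, Measure.smul_apply, Measure.map_apply (measurable_radialProjection n)
      .univ, preimage_univ, Measure.restrict_apply_univ, smul_eq_mul,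
      ENNReal.inv_mul_cancel (volume_unitBall_ne_zero n) (volume_unitBall_ne_top n)]

theorem unitSphereMeasure_compl_sphere {n : ℕ} (hn : n ≠ 0) :
    unitSphereMeasure n (Metric.sphere 0 1)ᶜ = 0 := by
  have : Nonempty (Fin n) := ⟨⟨0, Nat.pos_of_ne_zero hn⟩⟩
  rw [unitSphereMeasure, Measure.smul_apply, Measure.map_apply (measurable_radialProjection n)
    Metric.isClosed_sphere.measurableSet.compl, smul_eq_mul]
  refine mul_eq_zero_of_right _ (measure_mono_null (t := {0}) ?_ ?_)
  · intro x hx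
    by_contra h
    have : ‖x‖ ≠ 0 := by simpa using h
    simp [norm_smul, this] at hx
  · exact Measure.restrict_le_self.absolutelyContinuous (measure_singleton 0)

theorem ae_norm_eq_one_unitSphereMeasure {n : ℕ} (hn : n ≠ 0) :
    ∀ᵐ y ∂unitSphereMeasure n, ‖y‖ = 1 := by
  have := unitSphereMeasure_compl_sphere hn
  filter_upwards [show (Metric.sphere 0 1) ∈ ae (unitSphereMeasure n) from this] with y hy
  simpa using hy

theorem lintegral_unitSphereMeasure_comp_isometry {n : ℕ}
    (e : EuclideanSpace ℝ (Fin n) ≃ₗᵢ[ℝ] EuclideanSpace ℝ (Fin n))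
    {f : EuclideanSpace ℝ (Fin n) → ℝ≥0∞} (hf : Measurable f) :
    ∫⁻ y, f (e y) ∂unitSphereMeasure n = ∫⁻ y, f y ∂unitSphereMeasure n := by
  rw [lintegral_unitSphereMeasure n hf,
    lintegral_unitSphereMeasure n (f := fun y => f (e y)) (hf.comp e.continuous.measurable)]
  congr 1
  rw [← lintegral_indicator measurableSet_ball, ← lintegral_indicator measurableSet_ball]
  symm
  rw [← e.measurePreserving.lintegral_comp_emb e.toMeasurableEquiv.measurableEmbedding]
  refine lintegral_congr fun x => ?_
  simp [indicator]

/-- The normalizing constant of the density `(sin θ)^m` on `(0, π)`. -/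
noncomputable def sinPowConst (m : ℕ) : ℝ := (∫ θ in (0 : ℝ)..Real.pi, Real.sin θ ^ m)⁻¹

theorem lintegral_sin_pow (m : ℕ) :
    ∫⁻ θ in Ioo 0 Real.pi, ENNReal.ofReal (Real.sin θ ^ m) =
      ENNReal.ofReal (∫ θ in (0 : ℝ)..Real.pi, Real.sin θ ^ m) := by
  rw [intervalIntegral.integral_of_le Real.pi_pos.le, ← integral_Ioc_eq_integral_Ioo.symm,
    ofReal_integral_eq_lintegral_ofReal]
  · exact (Continuous.integrableOn_Icc (by fun_prop)).mono_set Ioo_subset_Icc_self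
  · filter_upwards [ae_restrict_mem measurableSet_Ioo] with θ hθ
    exact pow_nonneg (Real.sin_pos_of_pos_of_lt_pi hθ.1 hθ.2).le _

/-- The law of the first coordinate under the uniform measure of the unit sphere. -/
theorem lintegral_unitSphereMeasure_coord_zero (m : ℕ) {g : ℝ → ℝ≥0∞} (hg : Measurable g) :
    ∫⁻ y, g (y 0) ∂unitSphereMeasure (m + 2) = ENNReal.ofReal (sinPowConst m) *
      ∫⁻ θ in Ioo 0 Real.pi, ENNReal.ofReal (Real.sin θ ^ m) * g (Real.cos θ) := by
  -- Only independence of C from g matters here; its value is read off afterwards from g = 1.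
  have main : ∃ C : ℝ≥0∞, ∀ g : ℝ → ℝ≥0∞, Measurable g →
      ∫⁻ y, g (y 0) ∂unitSphereMeasure (m + 2) =
        C * ∫⁻ θ in Ioo 0 Real.pi, ENNReal.ofReal (Real.sin θ ^ m) * g (Real.cos θ) := by
    refine ⟨(volume (Metric.ball (0 : EuclideanSpace ℝ (Fin (m + 2))) 1))⁻¹ *
      ((m + 1) * volume (Metric.ball (0 : EuclideanSpace ℝ (Fin (m + 1))) 1) *
        ∫⁻ s in Ioi (0 : ℝ), (Iio (1 : ℝ)).indicator (fun s => ENNReal.ofReal (s ^ (m + 1))) s),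
      fun g hg => ?_⟩
    have hF : Measurable (Function.uncurry fun s t : ℝ =>
        (Iio (1 : ℝ)).indicator (fun _ => g (s⁻¹ * t)) s) := by
      have : (Function.uncurry fun s t : ℝ => (Iio (1 : ℝ)).indicator (fun _ => g (s⁻¹ * t)) s) =
        (Prod.fst ⁻¹' Iio (1 : ℝ)).indicator fun p : ℝ × ℝ => g (p.1⁻¹ * p.2) := by
        ext p; simp [indicator, Function.uncurry]
      rw [this]
      exact (hg.comp (by fun_prop)).indicator (measurable_fst measurableSet_Iio)
    have hpol := lintegral_norm_coord_zero_eq_polar m hF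
    rw [lintegral_unitSphereMeasure _ (f := fun y => g (y 0)) (by fun_prop),
      ← lintegral_indicator measurableSet_ball, mul_assoc, mul_assoc]
    congr 1
    calc _ = ∫⁻ x : EuclideanSpace ℝ (Fin (m + 2)),
          (Iio (1 : ℝ)).indicator (fun _ => g (‖x‖⁻¹ * x 0)) ‖x‖ := by
          refine lintegral_congr fun x => ?_
          simp [indicator]
      _ = _ := hpol
      _ = _ := by
          rw [mul_assoc ((m : ℝ≥0∞) + 1), mul_assoc ((m : ℝ≥0∞) + 1)]
          congr 2
          rw [← lintegral_mul_const _ (Measurable.indicator (by fun_prop) measurableSet_Iio)]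
          refine setLIntegral_congr_fun measurableSet_Ioi fun s (hs : 0 < s) => ?_
          rw [← lintegral_const_mul _ (by fun_prop)]
          refine setLIntegral_congr_fun measurableSet_Ioo fun θ hθ => ?_
          by_cases h1 : s < 1
          · have hsin := (Real.sin_pos_of_pos_of_lt_pi hθ.1 hθ.2).le
            simp only [indicator, mem_Iio, h1, if_true]
            rw [inv_mul_cancel_left₀ hs.ne', mul_pow, ENNReal.ofReal_mul (by positivity), pow_succ',
              ENNReal.ofReal_mul hs.le]
            ring
          · simp [indicator, h1]
  obtain ⟨C, hC⟩ := main
  have h1 := hC 1 measurable_one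
  simp only [Pi.one_apply, lintegral_one, measure_univ, mul_one, lintegral_sin_pow] at h1
  have hpos : 0 < ∫ θ in (0 : ℝ)..Real.pi, Real.sin θ ^ m := integral_sin_pow_pos m
  rw [hC g hg, sinPowConst, ENNReal.ofReal_inv_of_pos hpos, ← ENNReal.eq_inv_of_mul_eq_one_left h1.symm]

end UnitSphereMeasure

end ConformalCapacity

namespace ConformalCapacity

open Set

/-! ### Logarithmic sine integrals -/

section LogSine

/-- `∫_0^π (sin θ)^m ln (1 + ρ² - 2 ρ cos θ) dθ`. -/
noncomputable def logSineIntegral (m : ℕ) (ρ : ℝ) : ℝ :=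
  ∫ θ in (0 : ℝ)..Real.pi, Real.sin θ ^ m * Real.log (1 + ρ ^ 2 - 2 * ρ * Real.cos θ)

/-- The argument of the logarithm is |e^{iθ} − ρ|², so circle averages of ln|z − ρ| give both
integrability and the value for m = 0. -/
theorem log_circleMap_sub (ρ θ : ℝ) :
    Real.log (1 + ρ ^ 2 - 2 * ρ * Real.cos θ) = 2 * Real.log ‖circleMap 0 1 θ - ρ‖ := by
  have : 1 + ρ ^ 2 - 2 * ρ * Real.cos θ = ‖circleMap 0 1 θ - ρ‖ ^ 2 := by
    rw [← Complex.normSq_eq_norm_sq, Complex.normSq_apply]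
    simp only [circleMap, Complex.ofReal_one, one_mul, zero_add, Complex.sub_re, Complex.sub_im,
      Complex.exp_ofReal_mul_I_re, Complex.exp_ofReal_mul_I_im, Complex.ofReal_re,
      Complex.ofReal_im]
    nlinarith [Real.sin_sq_add_cos_sq θ]
  rw [this, Real.log_pow]
  norm_num

theorem intervalIntegrable_log_cos (ρ : ℝ) :
    IntervalIntegrable (fun θ => Real.log (1 + ρ ^ 2 - 2 * ρ * Real.cos θ)) volume 0
      (2 * Real.pi) := by
  have h : CircleIntegrable (fun z : ℂ => Real.log ‖z - ρ‖) 0 1 :=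
    circleIntegrable_log_norm_sub_const 1
  simp only [log_circleMap_sub]
  exact IntervalIntegrable.const_mul h 2

theorem intervalIntegrable_sin_pow_mul_log (m : ℕ) (ρ : ℝ) :
    IntervalIntegrable (fun θ => Real.sin θ ^ m * Real.log (1 + ρ ^ 2 - 2 * ρ * Real.cos θ))
      volume 0 Real.pi :=
  ((intervalIntegrable_log_cos ρ).mono_set (by
    rw [uIcc_of_le Real.pi_pos.le, uIcc_of_le (by positivity)]
    exact Icc_subset_Icc_right (by linarith [Real.pi_pos]))).continuousOn_mul
    (by fun_prop)

/-- By Jensen's formula the full circle average of ln|z − ρ| is ln⁺|ρ| = 0, and the reflection θ ↦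
2π − θ shows that both half circles contribute equally. -/
theorem logSineIntegral_zero {ρ : ℝ} (hρ : |ρ| ≤ 1) : logSineIntegral 0 ρ = 0 := by
  have h := circleAverage_log_norm_sub_const_eq_posLog (a := (ρ : ℂ))
  rw [Real.posLog_eq_zero_iff _ |>.2 (by simpa using hρ), Real.circleAverage, smul_eq_mul,
    mul_eq_zero] at h
  replace h := h.resolve_left (by positivity)
  have hint := intervalIntegrable_log_cos ρ
  have hfull : ∫ θ in (0 : ℝ)..2 * Real.pi, Real.log (1 + ρ ^ 2 - 2 * ρ * Real.cos θ) = 0 := by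
    simp only [log_circleMap_sub, intervalIntegral.integral_const_mul, h, mul_zero]
  have hsub : ∀ a b : ℝ, a ∈ Icc 0 (2 * Real.pi) → b ∈ Icc 0 (2 * Real.pi) → IntervalIntegrable
      (fun θ => Real.log (1 + ρ ^ 2 - 2 * ρ * Real.cos θ)) volume a b := fun a b ha hb =>
    hint.mono_set (by
      rw [uIcc_of_le (a := 0) (by positivity)]
      exact uIcc_subset_Icc ha hb)
  have hpi : Real.pi ∈ Icc 0 (2 * Real.pi) := ⟨by positivity, by linarith [Real.pi_pos]⟩
  have hsplit := intervalIntegral.integral_add_adjacent_intervals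
    (hsub 0 Real.pi ⟨le_rfl, by positivity⟩ hpi)
    (hsub Real.pi (2 * Real.pi) hpi ⟨by positivity, le_rfl⟩)
  have hrefl : ∫ θ in Real.pi..2 * Real.pi, Real.log (1 + ρ ^ 2 - 2 * ρ * Real.cos θ) =
      ∫ θ in (0 : ℝ)..Real.pi, Real.log (1 + ρ ^ 2 - 2 * ρ * Real.cos θ) := by
    have := intervalIntegral.integral_comp_sub_left (a := 0) (b := Real.pi)
      (fun θ => Real.log (1 + ρ ^ 2 - 2 * ρ * Real.cos θ)) (2 * Real.pi)
    simp only [Real.cos_two_pi_sub, sub_zero] at this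
    rw [this]
    congr 1
    ring
  simp only [logSineIntegral, pow_zero, one_mul]
  linarith

theorem logSineIntegral_neg (m : ℕ) (ρ : ℝ) : logSineIntegral m (-ρ) = logSineIntegral m ρ := by
  have := intervalIntegral.integral_comp_sub_left (a := 0) (b := Real.pi)
    (fun θ => Real.sin θ ^ m * Real.log (1 + ρ ^ 2 - 2 * ρ * Real.cos θ)) Real.pi
  simp only [Real.sin_pi_sub, Real.cos_pi_sub, sub_self, sub_zero] at this
  rw [logSineIntegral, logSineIntegral, ← this]
  refine intervalIntegral.integral_congr fun θ _ => ?_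
  congr 2
  ring

/-- The integrand of the difference of two symmetrized logarithmic sine integrals. -/
noncomputable def logSineGap (ρ θ : ℝ) : ℝ :=
  (Real.log (1 + 1 ^ 2 - 2 * 1 * Real.cos θ) +
      Real.log (1 + (-1) ^ 2 - 2 * (-1) * Real.cos θ)) -
    (Real.log (1 + ρ ^ 2 - 2 * ρ * Real.cos θ) +
      Real.log (1 + (-ρ) ^ 2 - 2 * (-ρ) * Real.cos θ))

theorem intervalIntegrable_sin_pow_mul_logSineGap (m : ℕ) (ρ : ℝ) :
    IntervalIntegrable (fun θ => Real.sin θ ^ m * logSineGap ρ θ) volume 0 Real.pi := by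
  simp only [logSineGap, mul_sub, mul_add]
  exact ((intervalIntegrable_sin_pow_mul_log m _).add (intervalIntegrable_sin_pow_mul_log m _)).sub
    ((intervalIntegrable_sin_pow_mul_log m _).add (intervalIntegrable_sin_pow_mul_log m _))

theorem integral_sin_pow_mul_logSineGap (m : ℕ) (ρ : ℝ) :
    ∫ θ in (0 : ℝ)..Real.pi, Real.sin θ ^ m * logSineGap ρ θ =
      2 * (logSineIntegral m 1 - logSineIntegral m ρ) := by
  have e : ∀ θ, Real.sin θ ^ m * logSineGap ρ θ =
      (Real.sin θ ^ m * Real.log (1 + 1 ^ 2 - 2 * 1 * Real.cos θ) +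
        Real.sin θ ^ m * Real.log (1 + (-1) ^ 2 - 2 * (-1) * Real.cos θ)) -
      (Real.sin θ ^ m * Real.log (1 + ρ ^ 2 - 2 * ρ * Real.cos θ) +
        Real.sin θ ^ m * Real.log (1 + (-ρ) ^ 2 - 2 * (-ρ) * Real.cos θ)) := fun θ => by
    rw [logSineGap]; ring
  have hi := fun x => intervalIntegrable_sin_pow_mul_log m x
  simp_rw [e]
  rw [intervalIntegral.integral_sub ((hi _).add (hi _)) ((hi _).add (hi _)),
    intervalIntegral.integral_add (hi _) (hi _), intervalIntegral.integral_add (hi _) (hi _)]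
  change (logSineIntegral m 1 + logSineIntegral m (-1)) -
    (logSineIntegral m ρ + logSineIntegral m (-ρ)) = _
  rw [logSineIntegral_neg, logSineIntegral_neg]
  ring

/-- The constant a costs nothing, because the gap itself has integral zero (the case m = 0). It will
be chosen to match the sign change of the gap. -/
theorem integral_sin_pow_sub_mul_logSineGap (m : ℕ) {ρ : ℝ} (hρ : |ρ| ≤ 1) (a : ℝ) :
    ∫ θ in (0 : ℝ)..Real.pi, (Real.sin θ ^ m - a) * logSineGap ρ θ =
      2 * (logSineIntegral m 1 - logSineIntegral m ρ) := by
  have h0 := integral_sin_pow_mul_logSineGap 0 ρ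
  rw [logSineIntegral_zero hρ, logSineIntegral_zero (by simp)] at h0
  have hi0 := intervalIntegrable_sin_pow_mul_logSineGap 0 ρ
  simp only [pow_zero, one_mul, sub_self, mul_zero] at h0 hi0
  simp only [sub_mul]
  rw [intervalIntegral.integral_sub (intervalIntegrable_sin_pow_mul_logSineGap m ρ)
    (hi0.const_mul a), intervalIntegral.integral_const_mul, h0, integral_sin_pow_mul_logSineGap]
  ring

/-- Multiplying the factors for ρ and −ρ leaves a function of sin²θ alone; this is why the gap was
symmetrized, as it can now be compared with (sin θ)^m. -/
theorem logSineGap_eq {ρ θ : ℝ} (hθ : θ ∈ Ioo 0 Real.pi) :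
    0 < (1 - ρ ^ 2) ^ 2 + 4 * ρ ^ 2 * Real.sin θ ^ 2 ∧
    logSineGap ρ θ = Real.log (4 * Real.sin θ ^ 2) -
      Real.log ((1 - ρ ^ 2) ^ 2 + 4 * ρ ^ 2 * Real.sin θ ^ 2) := by
  have hs := Real.sin_pos_of_pos_of_lt_pi hθ.1 hθ.2
  have h1 := Real.sin_sq_add_cos_sq θ
  have hpos : ∀ x : ℝ, 0 < 1 + x ^ 2 - 2 * x * Real.cos θ := fun x => by
    nlinarith [sq_nonneg (x - Real.cos θ), pow_pos hs 2]
  have e1 : (1 + ρ ^ 2 - 2 * ρ * Real.cos θ) * (1 + (-ρ) ^ 2 - 2 * (-ρ) * Real.cos θ) =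
      (1 - ρ ^ 2) ^ 2 + 4 * ρ ^ 2 * Real.sin θ ^ 2 := by
    rw [Real.sin_sq]; ring
  have e2 : (1 + 1 ^ 2 - 2 * 1 * Real.cos θ) * (1 + (-1) ^ 2 - 2 * (-1) * Real.cos θ) =
      4 * Real.sin θ ^ 2 := by
    rw [Real.sin_sq]; ring
  refine ⟨e1 ▸ mul_pos (hpos _) (hpos _), ?_⟩
  rw [logSineGap, ← Real.log_mul (hpos _).ne' (hpos _).ne', ← Real.log_mul (hpos _).ne' (hpos _).ne',
    e1, e2]

/-- The gap is nonnegative where sin θ ≥ a and nonpositive where sin θ ≤ a, exactly like (sin θ)^m −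
a^m, so their product is pointwise nonnegative. -/
theorem logSineIntegral_le_one (m : ℕ) {ρ : ℝ} (h0 : 0 ≤ ρ) (h1 : ρ ≤ 1) :
    logSineIntegral m ρ ≤ logSineIntegral m 1 := by
  have hρ2 : 0 ≤ 1 - ρ ^ 2 := by nlinarith
  -- The zero of the gap: 4s² = (1 − ρ²)² + 4ρ²s² reduces, for ρ < 1, to 4s² = 1 − ρ².
  set a : ℝ := √(1 - ρ ^ 2) / 2 with ha
  have ha0 : 0 ≤ a := by positivity
  have ha2 : 4 * a ^ 2 = 1 - ρ ^ 2 := by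
    rw [ha, div_pow, Real.sq_sqrt hρ2]; ring
  have key : 0 ≤ ∫ θ in (0 : ℝ)..Real.pi, (Real.sin θ ^ m - a ^ m) * logSineGap ρ θ := by
    rw [intervalIntegral.integral_of_le Real.pi_pos.le, integral_Ioc_eq_integral_Ioo]
    refine setIntegral_nonneg measurableSet_Ioo fun θ hθ => ?_
    have hs := Real.sin_pos_of_pos_of_lt_pi hθ.1 hθ.2
    obtain ⟨hp, hg⟩ := logSineGap_eq (ρ := ρ) hθ
    rw [hg]
    rcases le_total a (Real.sin θ) with h | h
    · refine mul_nonneg (sub_nonneg.2 (pow_le_pow_left₀ ha0 h m))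
        (sub_nonneg.2 (Real.log_le_log hp ?_))
      have : a ^ 2 ≤ Real.sin θ ^ 2 := pow_le_pow_left₀ ha0 h 2
      nlinarith
    · refine mul_nonneg_of_nonpos_of_nonpos (sub_nonpos.2 (pow_le_pow_left₀ hs.le h m))
        (sub_nonpos.2 (Real.log_le_log (by positivity) ?_))
      have : Real.sin θ ^ 2 ≤ a ^ 2 := pow_le_pow_left₀ hs.le h 2
      nlinarith
  rw [integral_sin_pow_sub_mul_logSineGap m (abs_le.2 ⟨by linarith, h1⟩)] at key
  linarith

/-- The same comparison at ρ = 0, where the integral vanishes and the gap ln(4 sin²θ) changes sign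
at sin θ = 1/2. For m ≠ 0 the integrand is strictly positive on (π/6, π/2). -/
theorem logSineIntegral_one_pos {m : ℕ} (hm : m ≠ 0) : 0 < logSineIntegral m 1 := by
  have hz : logSineIntegral m 0 = 0 := by simp [logSineIntegral]
  have hid := integral_sin_pow_sub_mul_logSineGap m (ρ := 0) (by simp) ((1 / 2) ^ m)
  rw [hz] at hid
  have hgap : ∀ θ ∈ Ioo 0 Real.pi, logSineGap 0 θ = Real.log (4 * Real.sin θ ^ 2) := fun θ hθ => by
    simp [(logSineGap_eq (ρ := 0) hθ).2]
  have hint : IntervalIntegrable (fun θ => (Real.sin θ ^ m - (1 / 2) ^ m) * logSineGap 0 θ) volume 0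
      Real.pi := by
    have hi0 := intervalIntegrable_sin_pow_mul_logSineGap 0 0
    simp only [pow_zero, one_mul] at hi0
    exact hi0.continuousOn_mul (by fun_prop)
  have key : 0 < ∫ θ in (0 : ℝ)..Real.pi, (Real.sin θ ^ m - (1 / 2) ^ m) * logSineGap 0 θ := by
    rw [intervalIntegral.integral_of_le Real.pi_pos.le, integral_Ioc_eq_integral_Ioo,
      setIntegral_pos_iff_support_of_nonneg_ae]
    · refine lt_of_lt_of_le ?_ (measure_mono (s := Ioo (Real.pi / 6) (Real.pi / 2)) ?_)
      · rw [Real.volume_Ioo]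
        exact ENNReal.ofReal_pos.2 (by linarith [Real.pi_pos])
      · intro θ hθ
        have hθ' : θ ∈ Ioo 0 Real.pi := ⟨by linarith [hθ.1, Real.pi_pos], by linarith [hθ.2, Real.pi_pos]⟩
        refine ⟨?_, hθ'⟩
        have hs : 1 / 2 < Real.sin θ := by
          rw [← Real.sin_pi_div_six]
          exact Real.sin_lt_sin_of_lt_of_le_pi_div_two (by linarith [Real.pi_pos]) hθ.2.le hθ.1
        rw [Function.mem_support, hgap θ hθ']
        refine (mul_pos (sub_pos.2 (pow_lt_pow_left₀ hs (by norm_num) hm)) (Real.log_pos ?_)).ne'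
        nlinarith
    · filter_upwards [ae_restrict_mem measurableSet_Ioo] with θ hθ
      have hs := Real.sin_pos_of_pos_of_lt_pi hθ.1 hθ.2
      simp only [Pi.zero_apply, hgap θ hθ]
      rcases le_total (1 / 2) (Real.sin θ) with h | h
      · exact mul_nonneg (sub_nonneg.2 (pow_le_pow_left₀ (by norm_num) h m))
          (Real.log_nonneg (by nlinarith))
      · exact mul_nonneg_of_nonpos_of_nonpos (sub_nonpos.2 (pow_le_pow_left₀ hs.le h m))
          (Real.log_nonpos (by positivity) (by nlinarith))
    · exact (intervalIntegrable_iff_integrableOn_Ioo_of_le Real.pi_pos.le).1 hint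
  linarith

/-- `σ_m / σ_{m+1}` normalizes the density `(sin θ)^m` on `(0, π)`. -/
theorem sphereArea_div_sphereArea {m : ℕ} (hm : m ≠ 0) :
    sphereArea m / sphereArea (m + 1) = sinPowConst m := by
  have hstep : ∀ k : ℕ, ∫ θ in (0 : ℝ)..Real.pi, Real.sin θ ^ k =
      √Real.pi * Real.Gamma (((k : ℝ) + 1) / 2) / Real.Gamma (((k : ℝ) + 2) / 2) := by
    -- Two consecutive exponents are carried, since the reduction formula for sine powers goes from
    -- k to k + 2.
    have two : ∀ k : ℕ, (∫ θ in (0 : ℝ)..Real.pi, Real.sin θ ^ k =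
        √Real.pi * Real.Gamma (((k : ℝ) + 1) / 2) / Real.Gamma (((k : ℝ) + 2) / 2)) ∧
        (∫ θ in (0 : ℝ)..Real.pi, Real.sin θ ^ (k + 1) =
        √Real.pi * Real.Gamma (((k + 1 : ℕ) + 1 : ℝ) / 2) /
          Real.Gamma (((k + 1 : ℕ) + 2 : ℝ) / 2)) := by
      intro k
      induction k with
      | zero =>
        constructor
        · have : Real.Gamma 2⁻¹ = √Real.pi := by rw [← Real.Gamma_one_half_eq]; norm_num
          simp [this, Real.mul_self_sqrt Real.pi_pos.le]
        · have : Real.Gamma (3 / 2) = √Real.pi / 2 := by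
            rw [show (3 / 2 : ℝ) = 1 / 2 + 1 by norm_num, Real.Gamma_add_one (by norm_num),
              Real.Gamma_one_half_eq]
            ring
          norm_num [this]
          field_simp
      | succ k ih =>
        refine ⟨ih.2, ?_⟩
        rw [show k + 1 + 1 = k + 2 from rfl, integral_sin_pow, ih.1]
        have g1 : Real.Gamma (((k + 2 : ℕ) + 1 : ℝ) / 2) =
            ((k : ℝ) + 1) / 2 * Real.Gamma (((k : ℝ) + 1) / 2) := by
          rw [← Real.Gamma_add_one (by positivity)]
          push_cast
          ring_nf
        have g2 : Real.Gamma (((k + 2 : ℕ) + 2 : ℝ) / 2) =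
            ((k : ℝ) + 2) / 2 * Real.Gamma (((k : ℝ) + 2) / 2) := by
          rw [← Real.Gamma_add_one (by positivity)]
          push_cast
          ring_nf
        have hG : Real.Gamma (((k : ℝ) + 2) / 2) ≠ 0 := (Real.Gamma_pos_of_pos (by positivity)).ne'
        rw [g1, g2]
        simp
        field_simp
    exact fun k => (two k).1
  have hG1 : Real.Gamma (((m : ℝ) + 1) / 2) ≠ 0 := (Real.Gamma_pos_of_pos (by positivity)).ne'
  have hG2 : Real.Gamma (((m : ℝ) + 2) / 2) ≠ 0 := (Real.Gamma_pos_of_pos (by positivity)).ne'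
  rw [sinPowConst, hstep, sphereArea, sphereArea, if_neg hm, if_neg (Nat.succ_ne_zero m)]
  push_cast
  rw [show ((m : ℝ) + 1 + 1) / 2 = ((m : ℝ) + 1) / 2 + 1 / 2 by ring,
    Real.rpow_add Real.pi_pos, ← Real.sqrt_eq_rpow,
    show ((m : ℝ) + 1) / 2 + 1 / 2 = ((m : ℝ) + 2) / 2 by ring]
  have h1 : Real.pi ^ (((m : ℝ) + 1) / 2) ≠ 0 := (Real.rpow_pos_of_pos Real.pi_pos _).ne'
  have h2 : √Real.pi ≠ 0 := by positivity
  field_simp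

end LogSine

end ConformalCapacity

namespace ConformalCapacity

open Set

/-! ### The logarithmic kernel as a mixture of Gaussians -/

section LogKernel

variable {n : ℕ}

theorem logKernel_self (x : EuclideanSpace ℝ (Fin n)) : logKernel x x = ⊤ := by
  simp [logKernel]

theorem logKernel_of_ne {x y : EuclideanSpace ℝ (Fin n)} (h : x ≠ y) :
    logKernel x y = ((-Real.log (dist x y) : ℝ) : EReal) := by
  rw [logKernel, ENNReal.log_inv, edist_dist, ENNReal.log_ofReal_of_pos (dist_pos.2 h),
    EReal.coe_neg]

theorem logKernel_comm (x y : EuclideanSpace ℝ (Fin n)) : logKernel x y = logKernel y x := by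
  rw [logKernel, logKernel, edist_comm]

theorem measurable_logKernel :
    Measurable fun p : EuclideanSpace ℝ (Fin n) × EuclideanSpace ℝ (Fin n) => logKernel p.1 p.2 := by
  unfold logKernel
  exact (Measurable.inv (by fun_prop)).ennreal_log

theorem lintegral_exp_neg_mul {t A B : ℝ} (ht : 0 < t) (hAB : A ≤ B) :
    ∫⁻ v in Ioo A B, ENNReal.ofReal (Real.exp (-(t * v))) =
      ENNReal.ofReal ((Real.exp (-(t * A)) - Real.exp (-(t * B))) / t) := by
  rw [← ofReal_integral_eq_lintegral_ofReal
    ((Continuous.integrableOn_Icc (by fun_prop)).mono_set Ioo_subset_Icc_self)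
    (ae_of_all _ fun v => (Real.exp_pos _).le), ← integral_Ioc_eq_integral_Ioo,
    ← intervalIntegral.integral_of_le hAB]
  congr 1
  have hd : ∀ v ∈ uIcc A B, HasDerivAt (fun v => -Real.exp (-(t * v)) / t) (Real.exp (-(t * v))) v := by
    intro v _
    have := ((((hasDerivAt_id v).const_mul t).neg.exp).neg).div_const t
    refine this.congr_deriv ?_
    simp [ht.ne']
  rw [intervalIntegral.integral_eq_sub_of_hasDerivAt hd
    (Continuous.intervalIntegrable (by fun_prop) _ _)]
  ring

theorem lintegral_exp_neg_mul_Ioi {v : ℝ} (hv : 0 < v) :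
    ∫⁻ t in Ioi (0 : ℝ), ENNReal.ofReal (Real.exp (-(t * v))) = ENNReal.ofReal v⁻¹ := by
  have e : ∀ t : ℝ, -(t * v) = -v * t := fun t => by ring
  simp only [e]
  rw [← ofReal_integral_eq_lintegral_ofReal (integrableOn_exp_mul_Ioi (by linarith) 0)
    (ae_of_all _ fun v => (Real.exp_pos _).le), integral_exp_mul_Ioi (by linarith)]
  simp

theorem lintegral_inv_Ioo {A B : ℝ} (hA : 0 < A) (hAB : A ≤ B) :
    ∫⁻ v in Ioo A B, ENNReal.ofReal v⁻¹ = ENNReal.ofReal (Real.log (B / A)) := by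
  have hcont : ContinuousOn (fun v : ℝ => v⁻¹) (Icc A B) :=
    continuousOn_id.inv₀ fun v hv => (hA.trans_le hv.1).ne'
  rw [← ofReal_integral_eq_lintegral_ofReal (hcont.integrableOn_Icc.mono_set Ioo_subset_Icc_self),
    ← integral_Ioc_eq_integral_Ioo, ← intervalIntegral.integral_of_le hAB,
    integral_inv_of_pos hA (hA.trans_le hAB)]
  filter_upwards [ae_restrict_mem measurableSet_Ioo] with v hv
  exact inv_nonneg.2 (hA.trans hv.1).le

/-- Covers the diagonal x = y of the Gaussian representation, where the kernel is +∞. -/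
theorem lintegral_inv_Ioo_zero {B : ℝ} (hB : 0 < B) :
    ∫⁻ v in Ioo 0 B, ENNReal.ofReal v⁻¹ = ⊤ := by
  refine ENNReal.eq_top_of_forall_nnreal_le fun N => ?_
  have h1 : B * Real.exp (-N) ≤ B := mul_le_of_le_one_right hB.le (by simp)
  calc (N : ℝ≥0∞) = ∫⁻ v in Ioo (B * Real.exp (-N)) B, ENNReal.ofReal v⁻¹ := by
        rw [lintegral_inv_Ioo (by positivity) h1, div_mul_cancel_left₀ hB.ne', ← Real.exp_neg]
        simp
    _ ≤ _ := lintegral_mono_set (Ioo_subset_Ioo_left (by positivity))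

/-- Frullani's integral for the exponential function, with values in `[0, ∞]`. -/
theorem lintegral_frullani_exp {A B : ℝ} (hA : 0 ≤ A) (hAB : A ≤ B) :
    ∫⁻ t in Ioi (0 : ℝ), ENNReal.ofReal ((Real.exp (-(t * A)) - Real.exp (-(t * B))) / t) =
      ∫⁻ v in Ioo A B, ENNReal.ofReal v⁻¹ := by
  calc _ = ∫⁻ t in Ioi (0 : ℝ), ∫⁻ v in Ioo A B, ENNReal.ofReal (Real.exp (-(t * v))) :=
        setLIntegral_congr_fun measurableSet_Ioi fun t ht => (lintegral_exp_neg_mul ht hAB).symm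
    _ = ∫⁻ v in Ioo A B, ∫⁻ t in Ioi (0 : ℝ), ENNReal.ofReal (Real.exp (-(t * v))) :=
        lintegral_lintegral_swap (by fun_prop)
    _ = _ := setLIntegral_congr_fun measurableSet_Ioo fun v hv =>
        lintegral_exp_neg_mul_Ioi (hA.trans_lt hv.1)

/-- The shifted logarithmic kernel as a superposition of Gaussian kernels. -/
theorem logKernel_add_log_toENNReal {x y : EuclideanSpace ℝ (Fin n)} {R : ℝ} (hR : 0 < R)
    (hxy : dist x y ≤ R) :
    (logKernel x y + (Real.log R : EReal)).toENNReal =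
      ∫⁻ t in Ioi (0 : ℝ), ENNReal.ofReal
        ((Real.exp (-(t * dist x y ^ 2)) - Real.exp (-(t * R ^ 2))) / t) / 2 := by
  simp only [div_eq_mul_inv _ (2 : ℝ≥0∞)]
  -- Frullani with A = |x − y|² and B = R² produces ln(R²/|x − y|²), which is twice the shifted
  -- kernel; hence the factor 1/2.
  rw [lintegral_mul_const _ (by fun_prop), lintegral_frullani_exp (by positivity)
    (by gcongr)]
  rcases eq_or_ne x y with rfl | h
  · rw [logKernel_self, dist_self, zero_pow two_ne_zero, lintegral_inv_Ioo_zero (by positivity),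
      EReal.top_add_coe, ENNReal.top_mul (by simp), EReal.toENNReal_top]
  · have hd := dist_pos.2 h
    rw [logKernel_of_ne h, lintegral_inv_Ioo (by positivity) (by gcongr), ← div_pow, Real.log_pow,
      Real.log_div hR.ne' hd.ne', ← EReal.coe_add, EReal.real_coe_toENNReal,
      ENNReal.ofReal_mul (by norm_num), mul_comm (ENNReal.ofReal _), mul_assoc, ← div_eq_mul_inv]
    simp only [Nat.cast_ofNat, ENNReal.ofReal_ofNat]
    rw [ENNReal.div_self (by simp) (by simp), mul_one]
    congr 1
    ring

end LogKernel

/-! ### Positive definiteness of the logarithmic kernel -/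

section PositiveDefinite

variable {n : ℕ}

/-- The mutual energy of two measures for the Gaussian kernel. -/
noncomputable def gaussEnergy (t : ℝ) (μ ν : Measure (EuclideanSpace ℝ (Fin n))) : ℝ≥0∞ :=
  ∫⁻ x, ∫⁻ y, ENNReal.ofReal (Real.exp (-(t * dist x y ^ 2))) ∂ν ∂μ

theorem lintegral_gaussian {b : ℝ} (hb : 0 < b) :
    ∫⁻ z : EuclideanSpace ℝ (Fin n), ENNReal.ofReal (Real.exp (-b * ‖z‖ ^ 2)) ≠ 0 ∧
    ∫⁻ z : EuclideanSpace ℝ (Fin n), ENNReal.ofReal (Real.exp (-b * ‖z‖ ^ 2)) ≠ ⊤ := by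
  have h := GaussianFourier.integral_rexp_neg_mul_sq_norm (V := EuclideanSpace ℝ (Fin n)) hb
  have hpos : 0 < ∫ z : EuclideanSpace ℝ (Fin n), Real.exp (-b * ‖z‖ ^ 2) := by
    rw [h]; positivity
  have hint : Integrable fun z : EuclideanSpace ℝ (Fin n) => Real.exp (-b * ‖z‖ ^ 2) := by
    by_contra hc
    exact hpos.ne' (integral_undef hc)
  rw [← ofReal_integral_eq_lintegral_ofReal hint (ae_of_all _ fun v => (Real.exp_pos _).le)]
  exact ⟨(ENNReal.ofReal_pos.2 hpos).ne', ENNReal.ofReal_ne_top⟩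

/-- By the parallelogram law, 2|x − z|² + 2|y − z|² = |x − y|² + 4|z − (x + y)/2|²; translation
invariance then removes the midpoint. -/
theorem lintegral_gaussian_mul_gaussian (t : ℝ) (x y : EuclideanSpace ℝ (Fin n)) :
    ∫⁻ z, ENNReal.ofReal (Real.exp (-(2 * t * dist x z ^ 2))) *
        ENNReal.ofReal (Real.exp (-(2 * t * dist y z ^ 2))) =
      ENNReal.ofReal (Real.exp (-(t * dist x y ^ 2))) *
        ∫⁻ z : EuclideanSpace ℝ (Fin n), ENNReal.ofReal (Real.exp (-(4 * t) * ‖z‖ ^ 2)) := by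
  have key : ∀ z : EuclideanSpace ℝ (Fin n),
      2 * dist x z ^ 2 + 2 * dist y z ^ 2 =
        dist x y ^ 2 + 4 * ‖z - (1 / 2 : ℝ) • (x + y)‖ ^ 2 := by
    intro z
    have h := parallelogram_law_with_norm ℝ (x - z) (y - z)
    have e1 : x - z + (y - z) = (-2 : ℝ) • (z - (1 / 2 : ℝ) • (x + y)) := by module
    rw [e1, norm_smul, sub_sub_sub_cancel_right] at h
    simp only [dist_eq_norm]
    norm_num at h ⊢
    nlinarith
  rw [← lintegral_const_mul _ (by fun_prop), ← lintegral_sub_right_eq_self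
    (fun z => ENNReal.ofReal (Real.exp (-(t * dist x y ^ 2))) *
      ENNReal.ofReal (Real.exp (-(4 * t) * ‖z‖ ^ 2))) ((1 / 2 : ℝ) • (x + y))]
  refine lintegral_congr fun z => ?_
  rw [← ENNReal.ofReal_mul (Real.exp_pos _).le, ← ENNReal.ofReal_mul (Real.exp_pos _).le,
    ← Real.exp_add, ← Real.exp_add]
  congr 2
  linear_combination (-t) * key z

/-- The Gaussian being a convolution square up to a constant, mutual energy is an L² inner product
of smoothed measures. Positive definiteness then follows from 2ab ≤ a² + b² under the integral, with
no subtraction in `ℝ≥0∞`. -/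
theorem gaussEnergy_mul_eq (t : ℝ) (μ ν : Measure (EuclideanSpace ℝ (Fin n))) [SFinite μ]
    [SFinite ν] :
    gaussEnergy t μ ν *
        ∫⁻ z : EuclideanSpace ℝ (Fin n), ENNReal.ofReal (Real.exp (-(4 * t) * ‖z‖ ^ 2)) =
      ∫⁻ z, (∫⁻ x, ENNReal.ofReal (Real.exp (-(2 * t * dist x z ^ 2))) ∂μ) *
        ∫⁻ y, ENNReal.ofReal (Real.exp (-(2 * t * dist y z ^ 2))) ∂ν := by
  rw [gaussEnergy, ← lintegral_mul_const _ (by fun_prop)]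
  calc _ = ∫⁻ x, ∫⁻ y, ∫⁻ z, ENNReal.ofReal (Real.exp (-(2 * t * dist x z ^ 2))) *
        ENNReal.ofReal (Real.exp (-(2 * t * dist y z ^ 2))) ∂volume ∂ν ∂μ := by
        refine lintegral_congr fun x => ?_
        rw [← lintegral_mul_const _ (by fun_prop)]
        exact lintegral_congr fun y => (lintegral_gaussian_mul_gaussian t x y).symm
    _ = ∫⁻ x, ∫⁻ z, ∫⁻ y, ENNReal.ofReal (Real.exp (-(2 * t * dist x z ^ 2))) *
        ENNReal.ofReal (Real.exp (-(2 * t * dist y z ^ 2))) ∂ν ∂volume ∂μ :=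
        lintegral_congr fun x => lintegral_lintegral_swap (by fun_prop)
    _ = ∫⁻ z, ∫⁻ x, ∫⁻ y, ENNReal.ofReal (Real.exp (-(2 * t * dist x z ^ 2))) *
        ENNReal.ofReal (Real.exp (-(2 * t * dist y z ^ 2))) ∂ν ∂μ :=
        lintegral_lintegral_swap (by fun_prop)
    _ = _ := by
        refine lintegral_congr fun z => ?_
        rw [← lintegral_mul_const _ (by fun_prop)]
        exact lintegral_congr fun x => lintegral_const_mul _ (by fun_prop)

theorem two_mul_mul_le_add_mul_self_ennreal (a b : ℝ≥0∞) : 2 * (a * b) ≤ a * a + b * b := by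
  rcases eq_or_ne a ⊤ with rfl | ha
  · simp
  rcases eq_or_ne b ⊤ with rfl | hb
  · simp
  lift a to NNReal using ha
  lift b to NNReal using hb
  norm_cast
  rw [← NNReal.coe_le_coe]
  push_cast
  nlinarith [sq_nonneg ((a : ℝ) - b)]

theorem two_mul_gaussEnergy_le {t : ℝ} (ht : 0 < t) (μ ν : Measure (EuclideanSpace ℝ (Fin n)))
    [SFinite μ] [SFinite ν] :
    2 * gaussEnergy t μ ν ≤ gaussEnergy t μ μ + gaussEnergy t ν ν := by
  obtain ⟨h0, h1⟩ := lintegral_gaussian (n := n) (b := 4 * t) (by positivity)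
  rw [← ENNReal.mul_le_mul_iff_left h0 h1, mul_assoc, add_mul, gaussEnergy_mul_eq,
    gaussEnergy_mul_eq, gaussEnergy_mul_eq, ← lintegral_const_mul _ (by fun_prop),
    ← lintegral_add_left (by fun_prop)]
  exact lintegral_mono fun z => two_mul_mul_le_add_mul_self_ennreal _ _

/-- The mutual energy of two measures for the kernel `(ln (1 / |x - y|) + c)⁺`. -/
noncomputable def shiftedEnergy (c : ℝ) (μ ν : Measure (EuclideanSpace ℝ (Fin n))) : ℝ≥0∞ :=
  ∫⁻ x, ∫⁻ y, (logKernel x y + (c : EReal)).toENNReal ∂ν ∂μ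

/-- Tonelli in the Gaussian parameter t. The distance bound makes the shifted kernel nonnegative,
and unit masses allow e^{-tR²} to be pulled out of the double integral. -/
theorem shiftedEnergy_log_eq {μ ν : Measure (EuclideanSpace ℝ (Fin n))} [IsProbabilityMeasure μ]
    [IsProbabilityMeasure ν] {R : ℝ} (hR : 0 < R) (hd : ∀ᵐ x ∂μ, ∀ᵐ y ∂ν, dist x y ≤ R) :
    shiftedEnergy (Real.log R) μ ν =
      ∫⁻ t in Ioi (0 : ℝ), (gaussEnergy t μ ν - ENNReal.ofReal (Real.exp (-(t * R ^ 2)))) *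
        (ENNReal.ofReal (2 * t))⁻¹ := by
  calc _ = ∫⁻ x, ∫⁻ y, ∫⁻ t in Ioi (0 : ℝ), ENNReal.ofReal
        ((Real.exp (-(t * dist x y ^ 2)) - Real.exp (-(t * R ^ 2))) / t) / 2 ∂volume ∂ν ∂μ := by
        refine lintegral_congr_ae ?_
        filter_upwards [hd] with x hx
        refine lintegral_congr_ae ?_
        filter_upwards [hx] with y hy
        exact logKernel_add_log_toENNReal hR hy
    _ = ∫⁻ x, ∫⁻ t in Ioi (0 : ℝ), ∫⁻ y, ENNReal.ofReal
        ((Real.exp (-(t * dist x y ^ 2)) - Real.exp (-(t * R ^ 2))) / t) / 2 ∂ν ∂volume ∂μ :=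
        lintegral_congr fun x => lintegral_lintegral_swap (by fun_prop)
    _ = ∫⁻ t in Ioi (0 : ℝ), ∫⁻ x, ∫⁻ y, ENNReal.ofReal
        ((Real.exp (-(t * dist x y ^ 2)) - Real.exp (-(t * R ^ 2))) / t) / 2 ∂ν ∂μ :=
        lintegral_lintegral_swap (by fun_prop)
    _ = _ := by
        refine setLIntegral_congr_fun measurableSet_Ioi fun t (ht : 0 < t) => ?_
        have e : ∀ x y : EuclideanSpace ℝ (Fin n), ENNReal.ofReal
            ((Real.exp (-(t * dist x y ^ 2)) - Real.exp (-(t * R ^ 2))) / t) / 2 =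
            (ENNReal.ofReal (Real.exp (-(t * dist x y ^ 2))) -
              ENNReal.ofReal (Real.exp (-(t * R ^ 2)))) * (ENNReal.ofReal (2 * t))⁻¹ := by
          intro x y
          rw [← ENNReal.ofReal_sub _ (Real.exp_pos _).le, ENNReal.ofReal_div_of_pos ht,
            ENNReal.ofReal_mul (by norm_num), ENNReal.mul_inv (by simp) (by simp),
            div_eq_mul_inv, div_eq_mul_inv]
          simp only [ENNReal.ofReal_ofNat]
          ring
        simp only [e]
        have e2 : ∀ x : EuclideanSpace ℝ (Fin n), ∫⁻ y, (ENNReal.ofReal (Real.exp (-(t * dist x y ^ 2))) -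
              ENNReal.ofReal (Real.exp (-(t * R ^ 2)))) * (ENNReal.ofReal (2 * t))⁻¹ ∂ν =
            (∫⁻ y, (ENNReal.ofReal (Real.exp (-(t * dist x y ^ 2))) -
              ENNReal.ofReal (Real.exp (-(t * R ^ 2)))) ∂ν) * (ENNReal.ofReal (2 * t))⁻¹ := fun x =>
          lintegral_mul_const _ (by fun_prop)
        simp only [e2]
        rw [lintegral_mul_const _ (by fun_prop)]
        congr 1
        refine ENNReal.eq_sub_of_add_eq ENNReal.ofReal_ne_top ?_
        rw [gaussEnergy]
        calc _ = ∫⁻ x, (∫⁻ y, (ENNReal.ofReal (Real.exp (-(t * dist x y ^ 2))) -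
              ENNReal.ofReal (Real.exp (-(t * R ^ 2)))) ∂ν) +
                ∫⁻ _, ENNReal.ofReal (Real.exp (-(t * R ^ 2))) ∂ν ∂μ := by
              rw [lintegral_add_left (by fun_prop)]
              simp
          _ = _ := by
              refine lintegral_congr_ae ?_
              filter_upwards [hd] with x hx
              rw [← lintegral_add_left (by fun_prop)]
              refine lintegral_congr_ae ?_
              filter_upwards [hx] with y hy
              refine tsub_add_cancel_of_le (ENNReal.ofReal_le_ofReal (Real.exp_le_exp.2 ?_))
              gcongr

/-- The logarithmic kernel is positive definite on differences of probability measures. -/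
theorem two_mul_shiftedEnergy_le {μ ν : Measure (EuclideanSpace ℝ (Fin n))}
    [IsProbabilityMeasure μ] [IsProbabilityMeasure ν] {R : ℝ} (hR : 0 < R)
    (hμ : ∀ᵐ x ∂μ, ‖x‖ ≤ R / 2) (hν : ∀ᵐ x ∂ν, ‖x‖ ≤ R / 2) :
    2 * shiftedEnergy (Real.log R) μ ν ≤
      shiftedEnergy (Real.log R) μ μ + shiftedEnergy (Real.log R) ν ν := by
  have hd : ∀ {α β : Measure (EuclideanSpace ℝ (Fin n))}, (∀ᵐ x ∂α, ‖x‖ ≤ R / 2) →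
      (∀ᵐ x ∂β, ‖x‖ ≤ R / 2) → ∀ᵐ x ∂α, ∀ᵐ y ∂β, dist x y ≤ R := by
    intro α β hα hβ
    filter_upwards [hα] with x hx
    filter_upwards [hβ] with y hy
    linarith [dist_le_norm_add_norm x y]
  have hge : ∀ {α β : Measure (EuclideanSpace ℝ (Fin n))} [IsProbabilityMeasure α]
      [IsProbabilityMeasure β], (∀ᵐ x ∂α, ∀ᵐ y ∂β, dist x y ≤ R) → ∀ t : ℝ, 0 < t →
      ENNReal.ofReal (Real.exp (-(t * R ^ 2))) ≤ gaussEnergy t α β := by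
    intro α β _ _ h t ht
    calc _ = ∫⁻ _, ∫⁻ _, ENNReal.ofReal (Real.exp (-(t * R ^ 2))) ∂β ∂α := by simp
      _ ≤ _ := by
        refine lintegral_mono_ae ?_
        filter_upwards [h] with x hx
        refine lintegral_mono_ae ?_
        filter_upwards [hx] with y hy
        refine ENNReal.ofReal_le_ofReal (Real.exp_le_exp.2 ?_)
        gcongr
  rw [shiftedEnergy_log_eq hR (hd hμ hν), shiftedEnergy_log_eq hR (hd hμ hμ),
    shiftedEnergy_log_eq hR (hd hν hν), ← lintegral_const_mul' _ _ (by simp),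
    ← lintegral_add_left (by unfold gaussEnergy; fun_prop)]
  refine lintegral_mono_ae ?_
  filter_upwards [ae_restrict_mem measurableSet_Ioi] with t ht
  have ht : 0 < t := ht
  rw [← mul_assoc, ← add_mul]
  gcongr
  -- Each pair of measures has total mass one, so the same e is subtracted from every Gaussian
  -- energy. Adding 2e to both sides removes it; `hge` ensures that no subtraction was truncated.
  set e := ENNReal.ofReal (Real.exp (-(t * R ^ 2))) with he
  have he' : e ≠ ⊤ := ENNReal.ofReal_ne_top
  refine (ENNReal.add_le_add_iff_right (a := 2 * e) (by finiteness)).1 ?_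
  calc 2 * (gaussEnergy t μ ν - e) + 2 * e = 2 * gaussEnergy t μ ν := by
        rw [← mul_add, tsub_add_cancel_of_le (hge (hd hμ hν) t ht)]
    _ ≤ gaussEnergy t μ μ + gaussEnergy t ν ν := two_mul_gaussEnergy_le ht μ ν
    _ = (gaussEnergy t μ μ - e + e) + (gaussEnergy t ν ν - e + e) := by
        rw [tsub_add_cancel_of_le (hge (hd hμ hμ) t ht), tsub_add_cancel_of_le (hge (hd hν hν) t ht)]
    _ = _ := by ring

end PositiveDefinite

end ConformalCapacity

namespace ConformalCapacity

open Set

/-! ### The equilibrium potential and minimal energy of the unit ball -/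

section Potential

theorem measurable_logKernel_right {n : ℕ} (x : EuclideanSpace ℝ (Fin n)) :
    Measurable fun y => logKernel x y := by
  unfold logKernel
  exact (Measurable.inv (by fun_prop)).ennreal_log

/-- The Robin constant of the closed unit ball of `ℝ^{m+2}`. -/
noncomputable def ballRobin (m : ℕ) : ℝ := -(sinPowConst m / 2 * logSineIntegral m 1)

theorem sinPowConst_pos (m : ℕ) : 0 < sinPowConst m := inv_pos.2 (integral_sin_pow_pos m)

theorem one_add_sq_sub_le_four {ρ c : ℝ} (h0 : 0 ≤ ρ) (h1 : ρ ≤ 1) (hc : -1 ≤ c) :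
    1 + ρ ^ 2 - 2 * ρ * c ≤ 4 := by nlinarith

theorem dist_smul_single_sq {m : ℕ} (ρ : ℝ) {y : EuclideanSpace ℝ (Fin (m + 2))} (hy : ‖y‖ = 1) :
    dist (EuclideanSpace.single 0 ρ) y = √(1 + ρ ^ 2 - 2 * ρ * y 0) := by
  rw [dist_eq_norm, ← Real.sqrt_sq (norm_nonneg _), norm_sub_sq_real, hy,
    EuclideanSpace.inner_single_left]
  congr 1
  simp
  ring

/-- The logarithmic potential of the uniform measure on the unit sphere inside the unit ball. -/
theorem lintegral_logKernel_unitSphereMeasure {m : ℕ} {x : EuclideanSpace ℝ (Fin (m + 2))}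
    (hx : ‖x‖ ≤ 1) :
    0 ≤ Real.log 2 - sinPowConst m / 2 * logSineIntegral m ‖x‖ ∧
    ∫⁻ y, (logKernel x y + (Real.log 2 : EReal)).toENNReal ∂unitSphereMeasure (m + 2) =
      ENNReal.ofReal (Real.log 2 - sinPowConst m / 2 * logSineIntegral m ‖x‖) := by
  set ρ := ‖x‖ with hρ
  have hρ0 : 0 ≤ ρ := norm_nonneg x
  -- A reflection exchanging two vectors of equal norm moves x to the first axis, so that the kernel
  -- depends on y only through its first coordinate.
  obtain ⟨e, he⟩ : ∃ e : EuclideanSpace ℝ (Fin (m + 2)) ≃ₗᵢ[ℝ] EuclideanSpace ℝ (Fin (m + 2)),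
      e x = EuclideanSpace.single 0 ρ :=
    ⟨_, Submodule.reflection_sub (by simp [hρ])⟩
  have hmeas : ∀ z : EuclideanSpace ℝ (Fin (m + 2)),
      Measurable fun y => (logKernel z y + (Real.log 2 : EReal)).toENNReal := fun z =>
    ((measurable_logKernel_right z).add_const _).ereal_toENNReal
  have hrot : ∫⁻ y, (logKernel x y + (Real.log 2 : EReal)).toENNReal ∂unitSphereMeasure (m + 2) =
      ∫⁻ y, (logKernel (EuclideanSpace.single 0 ρ) y + (Real.log 2 : EReal)).toENNReal
        ∂unitSphereMeasure (m + 2) := by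
    rw [← lintegral_unitSphereMeasure_comp_isometry e (hmeas (EuclideanSpace.single 0 ρ)), ← he]
    simp only [logKernel, e.isometry.edist_eq]
  set g : ℝ → ℝ≥0∞ := fun c => (ENNReal.log (ENNReal.ofReal √(1 + ρ ^ 2 - 2 * ρ * c))⁻¹ +
    (Real.log 2 : EReal)).toENNReal with hg
  have hgm : Measurable g :=
    ((Measurable.inv (by fun_prop)).ennreal_log.add_const _).ereal_toENNReal
  have hslice : ∫⁻ y, (logKernel (EuclideanSpace.single 0 ρ) y + (Real.log 2 : EReal)).toENNReal
        ∂unitSphereMeasure (m + 2) = ∫⁻ y, g (y 0) ∂unitSphereMeasure (m + 2) := by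
    refine lintegral_congr_ae ?_
    filter_upwards [ae_norm_eq_one_unitSphereMeasure (Nat.succ_ne_zero (m + 1))] with y hy
    rw [hg, logKernel, edist_dist, dist_smul_single_sq ρ hy]
  have hlog : ∀ θ ∈ Ioo 0 Real.pi, 0 ≤ Real.log 2 -
      1 / 2 * Real.log (1 + ρ ^ 2 - 2 * ρ * Real.cos θ) ∧
      g (Real.cos θ) = ENNReal.ofReal (Real.log 2 -
        1 / 2 * Real.log (1 + ρ ^ 2 - 2 * ρ * Real.cos θ)) := by
    intro θ hθ
    have hpos : 0 < 1 + ρ ^ 2 - 2 * ρ * Real.cos θ := by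
      have hs := Real.sin_pos_of_pos_of_lt_pi hθ.1 hθ.2
      nlinarith [sq_nonneg (ρ - Real.cos θ), pow_pos hs 2, Real.sin_sq_add_cos_sq θ]
    constructor
    · have h4 : Real.log (1 + ρ ^ 2 - 2 * ρ * Real.cos θ) ≤ Real.log (2 ^ 2) :=
        Real.log_le_log hpos (by
          linarith [one_add_sq_sub_le_four hρ0 hx (Real.neg_one_le_cos θ)])
      rw [Real.log_pow] at h4
      push_cast at h4
      linarith
    · rw [hg]
      simp only []
      rw [ENNReal.log_inv, ENNReal.log_ofReal_of_pos (Real.sqrt_pos.2 hpos), ← EReal.coe_neg,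
        ← EReal.coe_add, EReal.real_coe_toENNReal, Real.log_sqrt hpos.le]
      congr 1
      ring
  have hI : IntegrableOn (fun θ => Real.sin θ ^ m * (Real.log 2 -
      1 / 2 * Real.log (1 + ρ ^ 2 - 2 * ρ * Real.cos θ))) (Ioo 0 Real.pi) := by
    rw [← intervalIntegrable_iff_integrableOn_Ioo_of_le Real.pi_pos.le]
    have h1 : IntervalIntegrable (fun θ => Real.sin θ ^ m * Real.log 2) volume 0 Real.pi :=
      Continuous.intervalIntegrable (by fun_prop) _ _
    refine (h1.sub ((intervalIntegrable_sin_pow_mul_log m ρ).const_mul (1 / 2))).congr ?_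
    intro θ _
    simp only []
    ring
  have hnn : ∀ θ ∈ Ioo 0 Real.pi, 0 ≤ Real.sin θ ^ m * (Real.log 2 -
      1 / 2 * Real.log (1 + ρ ^ 2 - 2 * ρ * Real.cos θ)) := fun θ hθ =>
    mul_nonneg (pow_nonneg (Real.sin_pos_of_pos_of_lt_pi hθ.1 hθ.2).le _) (hlog θ hθ).1
  have hval : sinPowConst m * ∫ θ in Ioo 0 Real.pi, Real.sin θ ^ m * (Real.log 2 -
      1 / 2 * Real.log (1 + ρ ^ 2 - 2 * ρ * Real.cos θ)) =
      Real.log 2 - sinPowConst m / 2 * logSineIntegral m ρ := by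
    rw [← integral_Ioc_eq_integral_Ioo, ← intervalIntegral.integral_of_le Real.pi_pos.le]
    have h1 : IntervalIntegrable (fun θ => Real.sin θ ^ m * Real.log 2) volume 0 Real.pi :=
      Continuous.intervalIntegrable (by fun_prop) _ _
    have e : ∀ θ, Real.sin θ ^ m * (Real.log 2 -
        1 / 2 * Real.log (1 + ρ ^ 2 - 2 * ρ * Real.cos θ)) = Real.sin θ ^ m * Real.log 2 -
        1 / 2 * (Real.sin θ ^ m * Real.log (1 + ρ ^ 2 - 2 * ρ * Real.cos θ)) := fun θ => by ring
    simp only [e]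
    rw [intervalIntegral.integral_sub h1
      ((intervalIntegrable_sin_pow_mul_log m ρ).const_mul (1 / 2)),
      intervalIntegral.integral_const_mul, intervalIntegral.integral_mul_const, mul_sub,
      ← mul_assoc, sinPowConst, inv_mul_cancel₀ (integral_sin_pow_pos m).ne', logSineIntegral]
    ring
  constructor
  · rw [← hval]
    exact mul_nonneg (sinPowConst_pos m).le (setIntegral_nonneg measurableSet_Ioo hnn)
  · rw [hrot, hslice, lintegral_unitSphereMeasure_coord_zero m hgm, ← hval,
      ENNReal.ofReal_mul (sinPowConst_pos m).le, ofReal_integral_eq_lintegral_ofReal hI]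
    · congr 1
      refine setLIntegral_congr_fun measurableSet_Ioo fun θ hθ => ?_
      rw [(hlog θ hθ).2, ENNReal.ofReal_mul
        (pow_nonneg (Real.sin_pos_of_pos_of_lt_pi hθ.1 hθ.2).le _)]
    · filter_upwards [ae_restrict_mem measurableSet_Ioo] with θ hθ using hnn θ hθ

theorem log_two_add_ballRobin_nonneg (m : ℕ) : 0 ≤ Real.log 2 + ballRobin m := by
  have := (lintegral_logKernel_unitSphereMeasure (m := m)
    (x := EuclideanSpace.single 0 1) (by simp)).1
  simp only [PiLp.norm_single, norm_one] at this
  rw [ballRobin]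
  linarith

theorem shiftedEnergy_unitSphereMeasure (m : ℕ) :
    shiftedEnergy (Real.log 2) (unitSphereMeasure (m + 2)) (unitSphereMeasure (m + 2)) =
      ENNReal.ofReal (Real.log 2 + ballRobin m) := by
  calc _ = ∫⁻ _, ENNReal.ofReal (Real.log 2 + ballRobin m) ∂unitSphereMeasure (m + 2) := by
        refine lintegral_congr_ae ?_
        filter_upwards [ae_norm_eq_one_unitSphereMeasure (Nat.succ_ne_zero (m + 1))] with y hy
        rw [(lintegral_logKernel_unitSphereMeasure hy.le).2, hy, ballRobin, sub_eq_add_neg]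
    _ = _ := by simp

/-- With σ the sphere measure, 2 I(μ, σ) ≤ I(μ) + I(σ). The potential of σ in the ball is at least
its value on the sphere, so I(μ, σ) ≥ I(σ), and cancelling the finite I(σ) leaves I(μ) ≥ I(σ). -/
theorem le_shiftedEnergy_unitBall {m : ℕ} {μ : Measure (EuclideanSpace ℝ (Fin (m + 2)))}
    [IsProbabilityMeasure μ] (hμ : ∀ᵐ x ∂μ, ‖x‖ ≤ 1) :
    ENNReal.ofReal (Real.log 2 + ballRobin m) ≤ shiftedEnergy (Real.log 2) μ μ := by
  have h := two_mul_shiftedEnergy_le (μ := μ) (ν := unitSphereMeasure (m + 2)) two_pos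
    (by simpa using hμ) (by
      filter_upwards [ae_norm_eq_one_unitSphereMeasure (Nat.succ_ne_zero (m + 1))] with y hy
      simp [hy])
  have hmut : ENNReal.ofReal (Real.log 2 + ballRobin m) ≤
      shiftedEnergy (Real.log 2) μ (unitSphereMeasure (m + 2)) := by
    calc _ = ∫⁻ _, ENNReal.ofReal (Real.log 2 + ballRobin m) ∂μ := by simp
      _ ≤ _ := by
        refine lintegral_mono_ae ?_
        filter_upwards [hμ] with x hx
        rw [(lintegral_logKernel_unitSphereMeasure hx).2]
        refine ENNReal.ofReal_le_ofReal ?_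
        have := mul_le_mul_of_nonneg_left (logSineIntegral_le_one m (norm_nonneg x) hx)
          (half_pos (sinPowConst_pos m)).le
        rw [ballRobin]
        linarith
  rw [shiftedEnergy_unitSphereMeasure] at h
  refine (ENNReal.add_le_add_iff_right (a := ENNReal.ofReal (Real.log 2 + ballRobin m))
    ENNReal.ofReal_ne_top).1 (le_trans ?_ h)
  rw [← two_mul]
  gcongr

end Potential

/-! ### Robin constants of balls -/

section Robin

variable {n : ℕ}

/-- The identity (F + h)⁺ − (F + h)⁻ = F⁺ − F⁻ + h⁺ − h⁻ with every term on the side where its sign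
is plus. In this form it holds for F = ±∞ and can be integrated without meeting ∞ − ∞. -/
theorem toENNReal_add_coe_add (F : EReal) (h : ℝ) :
    (F + h).toENNReal + (-F).toENNReal + ENNReal.ofReal (-h) =
      (-(F + h)).toENNReal + F.toENNReal + ENNReal.ofReal h := by
  induction F with
  | bot => simp
  | top => simp
  | coe a =>
    rw [← EReal.coe_add, ← EReal.coe_neg, ← EReal.coe_neg]
    simp only [EReal.real_coe_toENNReal]
    have key : ∀ x : ℝ, ENNReal.ofReal x = ENNReal.ofReal (max x 0) := fun x => by
      rcases le_total x 0 with h | h <;> simp [h]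
    have key2 : ∀ x : ℝ, max x 0 = max (-x) 0 + x := fun x => by
      rcases le_total x 0 with h | h <;> simp [h]
    rw [key (a + h), key (-a), key (-h), key (-(a + h)), key a, key h,
      ← ENNReal.ofReal_add (by positivity) (by positivity),
      ← ENNReal.ofReal_add (by positivity) (by positivity),
      ← ENNReal.ofReal_add (by positivity) (by positivity),
      ← ENNReal.ofReal_add (by positivity) (by positivity)]
    congr 1
    linarith [key2 (a + h), key2 a, key2 h]

/-- Brings an integrated identity of the preceding kind back to a difference in `EReal`; finiteness
of the negative part is enough. -/
theorem coe_sub_coe_eq_of_add_eq {a b d : ℝ≥0∞} {c : ℝ} (hb : b ≠ ⊤)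
    (h : a + b + ENNReal.ofReal (-c) = d + ENNReal.ofReal c) :
    (d : EReal) - (b : EReal) = (a : EReal) - (c : EReal) := by
  lift b to NNReal using hb
  rcases eq_or_ne d ⊤ with rfl | hd
  · have : a = ⊤ := by
      by_contra ha
      exact absurd h (by rw [top_add]; finiteness)
    subst this
    rfl
  · have ha : a ≠ ⊤ := by
      rintro rfl
      exact absurd h.symm (by rw [top_add, top_add]; finiteness)
    lift a to NNReal using ha
    lift d to NNReal using hd
    have h' := congrArg ENNReal.toReal h
    rw [ENNReal.toReal_add (by finiteness) (by finiteness), ENNReal.toReal_add (by finiteness)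
      (by finiteness), ENNReal.toReal_add (by finiteness) (by finiteness),
      ENNReal.toReal_ofReal', ENNReal.toReal_ofReal'] at h'
    simp only [ENNReal.coe_toReal] at h'
    have hc : max c 0 - max (-c) 0 = c := max_zero_sub_max_neg_zero_eq_self c
    change ((d : ℝ) : EReal) - ((b : ℝ) : EReal) = ((a : ℝ) : EReal) - (c : EReal)
    rw [← EReal.coe_sub, ← EReal.coe_sub]
    congr 1
    linarith

/-- The logarithmic energy of a measure. -/
noncomputable def logEnergy (μ : Measure (EuclideanSpace ℝ (Fin n))) : EReal :=
  (posEnergy μ μ : EReal) - (negEnergy μ μ : EReal)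

/-- Measurability in the first variable of a partial integral over the second one. -/
theorem measurable_lintegral_logKernel {φ : EReal → ℝ≥0∞} (hφ : Measurable φ)
    (ν : Measure (EuclideanSpace ℝ (Fin n))) [SFinite ν] :
    Measurable fun x => ∫⁻ y, φ (logKernel x y) ∂ν :=
  Measurable.lintegral_prod_right'
    (f := fun p : EuclideanSpace ℝ (Fin n) × EuclideanSpace ℝ (Fin n) => φ (logKernel p.1 p.2))
    (hφ.comp measurable_logKernel)

theorem measurable_shift_toENNReal (c : ℝ) :
    Measurable fun a : EReal => (a + (c : EReal)).toENNReal :=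
  (measurable_id.add_const _).ereal_toENNReal

theorem neg_log_le_logKernel {x y : EuclideanSpace ℝ (Fin n)} {R : ℝ} (h : dist x y ≤ R) :
    ((-Real.log R : ℝ) : EReal) ≤ logKernel x y := by
  rcases eq_or_ne x y with rfl | hxy
  · rw [logKernel_self]; exact le_top
  · rw [logKernel_of_ne hxy, EReal.coe_le_coe_iff, neg_le_neg_iff]
    exact Real.log_le_log (dist_pos.2 hxy) h

theorem negEnergy_le_of_dist_le {μ ν : Measure (EuclideanSpace ℝ (Fin n))} [IsProbabilityMeasure μ]
    [IsProbabilityMeasure ν] {R : ℝ} (hd : ∀ᵐ x ∂μ, ∀ᵐ y ∂ν, dist x y ≤ R) :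
    negEnergy μ ν ≤ ENNReal.ofReal (Real.log R) := by
  calc negEnergy μ ν ≤ ∫⁻ _, ∫⁻ _, ENNReal.ofReal (Real.log R) ∂ν ∂μ := by
        refine lintegral_mono_ae ?_
        filter_upwards [hd] with x hx
        refine lintegral_mono_ae ?_
        filter_upwards [hx] with y hy
        rw [← EReal.real_coe_toENNReal]
        refine EReal.toENNReal_le_toENNReal (EReal.neg_le.1 ?_)
        rw [← EReal.coe_neg]
        exact neg_log_le_logKernel hy
    _ = _ := by simp

/-- On the support the kernel is at least −ln R, so the shifted kernel has no negative part. This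
transfers positive definiteness to the true energy. -/
theorem logEnergy_eq_shiftedEnergy_sub {μ : Measure (EuclideanSpace ℝ (Fin n))}
    [IsProbabilityMeasure μ] {R : ℝ} (hd : ∀ᵐ x ∂μ, ∀ᵐ y ∂μ, dist x y ≤ R) :
    logEnergy μ = (shiftedEnergy (Real.log R) μ μ : EReal) - (Real.log R : EReal) := by
  refine coe_sub_coe_eq_of_add_eq ((negEnergy_le_of_dist_le hd).trans_lt ENNReal.ofReal_lt_top).ne ?_
  have ms := measurable_shift_toENNReal (Real.log R)
  have ms' : ∀ x, Measurable fun y : EuclideanSpace ℝ (Fin n) =>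
      (logKernel x y + (Real.log R : EReal)).toENNReal :=
    fun x => ms.comp (measurable_logKernel_right x)
  have e1 : shiftedEnergy (Real.log R) μ μ + negEnergy μ μ + ENNReal.ofReal (-Real.log R) =
      ∫⁻ x, ∫⁻ y, (logKernel x y + (Real.log R : EReal)).toENNReal + (-logKernel x y).toENNReal +
        ENNReal.ofReal (-Real.log R) ∂μ ∂μ := by
    have : ∀ x, ∫⁻ y, (logKernel x y + (Real.log R : EReal)).toENNReal +
        (-logKernel x y).toENNReal + ENNReal.ofReal (-Real.log R) ∂μ =
        ∫⁻ y, (logKernel x y + (Real.log R : EReal)).toENNReal ∂μ +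
          ∫⁻ y, (-logKernel x y).toENNReal ∂μ + ENNReal.ofReal (-Real.log R) := fun x => by
      rw [lintegral_add_right _ measurable_const, lintegral_add_left (ms' x)]
      simp
    simp only [this]
    rw [lintegral_add_right _ measurable_const, lintegral_add_left (measurable_lintegral_logKernel ms μ)]
    simp [shiftedEnergy, negEnergy]
  have e2 : posEnergy μ μ + ENNReal.ofReal (Real.log R) =
      ∫⁻ x, ∫⁻ y, (logKernel x y).toENNReal + ENNReal.ofReal (Real.log R) ∂μ ∂μ := by
    have : ∀ x, ∫⁻ y, (logKernel x y).toENNReal + ENNReal.ofReal (Real.log R) ∂μ =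
        ∫⁻ y, (logKernel x y).toENNReal ∂μ + ENNReal.ofReal (Real.log R) := fun x => by
      rw [lintegral_add_right _ measurable_const]
      simp
    simp only [this]
    rw [lintegral_add_right _ measurable_const]
    simp [posEnergy]
  rw [e1, e2]
  refine lintegral_congr_ae ?_
  filter_upwards [hd] with x hx
  refine lintegral_congr_ae ?_
  filter_upwards [hx] with y hy
  have h0 : (-(logKernel x y + (Real.log R : EReal))).toENNReal = 0 := by
    refine EReal.toENNReal_of_nonpos ?_
    rw [EReal.neg_le, neg_zero]
    have := add_le_add_left (neg_log_le_logKernel hy) (Real.log R : EReal)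
    rwa [← EReal.coe_add, neg_add_cancel, EReal.coe_zero] at this
  rw [toENNReal_add_coe_add, h0, zero_add]

theorem logKernel_smul {r : ℝ} (hr : 0 < r) (x y : EuclideanSpace ℝ (Fin n)) :
    logKernel (r • x) (r • y) = logKernel x y - (Real.log r : EReal) := by
  rcases eq_or_ne x y with rfl | h
  · simp [logKernel_self]
  · have h' : r • x ≠ r • y := fun e => h (smul_right_injective _ hr.ne' e)
    rw [logKernel_of_ne h, logKernel_of_ne h', ← EReal.coe_sub, dist_smul₀, Real.norm_of_nonneg hr.le,
      Real.log_mul hr.ne' (dist_pos.2 h).ne']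
    congr 1
    ring

theorem shiftedEnergy_map_smul {r : ℝ} (hr : 0 < r) (c : ℝ)
    (μ : Measure (EuclideanSpace ℝ (Fin n))) [SFinite μ] :
    shiftedEnergy (c + Real.log r) (μ.map (r • ·)) (μ.map (r • ·)) = shiftedEnergy c μ μ := by
  have ms := measurable_shift_toENNReal (c + Real.log r)
  have ms' : ∀ x, Measurable fun y : EuclideanSpace ℝ (Fin n) =>
      (logKernel x y + ((c + Real.log r : ℝ) : EReal)).toENNReal :=
    fun x => ms.comp (measurable_logKernel_right x)
  rw [shiftedEnergy, lintegral_map (measurable_lintegral_logKernel ms _) (by fun_prop),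
    shiftedEnergy]
  refine lintegral_congr fun x => ?_
  rw [lintegral_map (ms' _) (by fun_prop)]
  refine lintegral_congr fun y => ?_
  rw [logKernel_smul hr, sub_eq_add_neg, add_assoc, ← EReal.coe_neg, ← EReal.coe_add]
  congr 3
  ring

theorem ae_dist_le_of_ae_norm_le {μ ν : Measure (EuclideanSpace ℝ (Fin n))} {r s : ℝ}
    (hμ : ∀ᵐ x ∂μ, ‖x‖ ≤ r) (hν : ∀ᵐ x ∂ν, ‖x‖ ≤ s) : ∀ᵐ x ∂μ, ∀ᵐ y ∂ν, dist x y ≤ r + s := by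
  filter_upwards [hμ] with x hx
  filter_upwards [hν] with y hy
  linarith [dist_le_norm_add_norm x y]

theorem isProbabilityMeasure_map_smul (r : ℝ) (μ : Measure (EuclideanSpace ℝ (Fin n)))
    [IsProbabilityMeasure μ] : IsProbabilityMeasure (μ.map (r • ·)) :=
  Measure.isProbabilityMeasure_map (by fun_prop)

theorem le_logEnergy_of_ae_norm_le {m : ℕ} {r : ℝ} (hr : 0 < r)
    {μ : Measure (EuclideanSpace ℝ (Fin (m + 2)))} [IsProbabilityMeasure μ]
    (hμ : ∀ᵐ x ∂μ, ‖x‖ ≤ r) :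
    ((ballRobin m - Real.log r : ℝ) : EReal) ≤ logEnergy μ := by
  have := isProbabilityMeasure_map_smul r⁻¹ μ
  have h1 : ∀ᵐ x ∂μ.map (r⁻¹ • ·), ‖x‖ ≤ 1 := by
    rw [ae_map_iff (by fun_prop) (measurableSet_le measurable_norm measurable_const)]
    filter_upwards [hμ] with x hx
    rw [norm_smul, norm_inv, Real.norm_of_nonneg hr.le]
    exact (inv_mul_le_one₀ hr).2 hx
  have h2 := le_shiftedEnergy_unitBall h1
  -- Scaling by r⁻¹ carries the shift ln(2r), adapted to the diameter, to the shift ln 2 of the unit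
  -- ball.
  have h3 := shiftedEnergy_map_smul (inv_pos.2 hr) (Real.log (2 * r)) μ
  rw [Real.log_mul two_ne_zero hr.ne', Real.log_inv, add_neg_cancel_right] at h3
  rw [h3] at h2
  rw [logEnergy_eq_shiftedEnergy_sub (R := 2 * r) (by
    rw [two_mul]; exact ae_dist_le_of_ae_norm_le hμ hμ), Real.log_mul two_ne_zero hr.ne']
  have h4 : ((ENNReal.ofReal (Real.log 2 + ballRobin m) : ℝ≥0∞) : EReal) ≤
    (shiftedEnergy (Real.log 2 + Real.log r) μ μ : EReal) := by exact_mod_cast h2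
  rw [EReal.coe_ennreal_ofReal, max_eq_left (log_two_add_ballRobin_nonneg m)] at h4
  have h5 := EReal.sub_le_sub h4 (le_refl ((Real.log 2 + Real.log r : ℝ) : EReal))
  refine le_trans (le_of_eq ?_) h5
  rw [← EReal.coe_sub]
  congr 1
  ring

/-- The uniform probability measure on the sphere of radius `r`. -/
noncomputable def sphereMeasure (n : ℕ) (r : ℝ) : Measure (EuclideanSpace ℝ (Fin n)) :=
  (unitSphereMeasure n).map (r • ·)

instance (n : ℕ) (r : ℝ) : IsProbabilityMeasure (sphereMeasure n r) :=
  isProbabilityMeasure_map_smul r _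

theorem ae_norm_eq_sphereMeasure {n : ℕ} (hn : n ≠ 0) {r : ℝ} (hr : 0 < r) :
    ∀ᵐ y ∂sphereMeasure n r, ‖y‖ = r := by
  rw [sphereMeasure, ae_map_iff (by fun_prop) (measurableSet_eq_fun measurable_norm measurable_const)]
  filter_upwards [ae_norm_eq_one_unitSphereMeasure hn] with y hy
  rw [norm_smul, hy, Real.norm_of_nonneg hr.le, mul_one]

theorem logEnergy_sphereMeasure (m : ℕ) {r : ℝ} (hr : 0 < r) :
    logEnergy (sphereMeasure (m + 2) r) = ((ballRobin m - Real.log r : ℝ) : EReal) := by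
  have hle : ∀ᵐ y ∂sphereMeasure (m + 2) r, ‖y‖ ≤ r :=
    (ae_norm_eq_sphereMeasure (Nat.succ_ne_zero _) hr).mono fun y hy => hy.le
  rw [logEnergy_eq_shiftedEnergy_sub (R := 2 * r) (by
    rw [two_mul]; exact ae_dist_le_of_ae_norm_le hle hle), Real.log_mul two_ne_zero hr.ne',
    sphereMeasure, shiftedEnergy_map_smul hr, shiftedEnergy_unitSphereMeasure,
    EReal.coe_ennreal_ofReal, max_eq_left (log_two_add_ballRobin_nonneg m), ← EReal.coe_sub]
  congr 1
  ring

theorem nrob_closedBall (m : ℕ) {r : ℝ} (hr : 0 < r) :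
    nrob (Metric.closedBall (0 : EuclideanSpace ℝ (Fin (m + 2))) r) =
      ((ballRobin m - Real.log r : ℝ) : EReal) := by
  have hcompl : ∀ μ : Measure (EuclideanSpace ℝ (Fin (m + 2))),
      μ (Metric.closedBall 0 r)ᶜ = 0 ↔ ∀ᵐ x ∂μ, ‖x‖ ≤ r := fun μ => by
    rw [ae_iff]
    congr! 2
    ext x
    simp
  refine le_antisymm ?_ ?_
  · rw [← logEnergy_sphereMeasure m hr]
    exact iInf_le_of_le _ (iInf_le_of_le inferInstance (iInf_le _ ((hcompl _).2
      ((ae_norm_eq_sphereMeasure (Nat.succ_ne_zero _) hr).mono fun y hy => hy.le))))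
  · refine le_iInf fun μ => le_iInf fun hμ => le_iInf fun hK => ?_
    exact le_logEnergy_of_ae_norm_le hr ((hcompl μ).1 hK)

theorem ncap3_closedBall (m : ℕ) {r : ℝ} (hr : 0 < r) :
    ncap3 (Metric.closedBall (0 : EuclideanSpace ℝ (Fin (m + 2))) r) =
      ENNReal.ofReal (r * Real.exp (-ballRobin m)) := by
  rw [ncap3, nrob_closedBall m hr, ← EReal.coe_neg, EReal.exp_coe, neg_sub, Real.exp_sub,
    Real.exp_log hr, Real.exp_neg, div_eq_mul_inv]

end Robin

end ConformalCapacity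

namespace ConformalCapacity

open Set

/-! ### Asymptotics of the transfinite modulus -/

section TransfiniteModulus

variable {n : ℕ}

theorem posEnergy_comm (μ ν : Measure (EuclideanSpace ℝ (Fin n))) [SFinite μ] [SFinite ν] :
    posEnergy μ ν = posEnergy ν μ := by
  rw [posEnergy, lintegral_lintegral_swap measurable_logKernel.ereal_toENNReal.aemeasurable,
    posEnergy]
  simp only [logKernel_comm]

theorem negEnergy_comm (μ ν : Measure (EuclideanSpace ℝ (Fin n))) [SFinite μ] [SFinite ν] :
    negEnergy μ ν = negEnergy ν μ := by
  rw [negEnergy, lintegral_lintegral_swap measurable_logKernel.neg.ereal_toENNReal.aemeasurable,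
    negEnergy]
  simp only [logKernel_comm]

theorem measurable_neg_toENNReal : Measurable fun a : EReal => (-a).toENNReal :=
  measurable_id.neg.ereal_toENNReal

/-- The logarithmic moment `∫ ln⁺ |y| dν(y)`. -/
noncomputable def logMoment (ν : Measure (EuclideanSpace ℝ (Fin n))) : ℝ≥0∞ :=
  ∫⁻ y, ENNReal.ofReal (Real.log ‖y‖) ∂ν

/-- The ratio |x − y|/|y| lies between 1 − q and 1 + q ≤ 1/(1 − q) with q = ρ/r, so one error term
serves both sides. The margin r ≥ ρ + 1 keeps distances between the plates at least 1, so the kernel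
has a fixed sign there. -/
theorem abs_log_dist_sub_log_norm_le {x y : EuclideanSpace ℝ (Fin n)} {ρ r : ℝ} (hρ : 0 ≤ ρ)
    (hr : ρ + 1 ≤ r) (hx : ‖x‖ ≤ ρ) (hy : r ≤ ‖y‖) :
    1 ≤ dist x y ∧ Real.log ‖y‖ ≤ Real.log (dist x y) + -Real.log (1 - ρ / r) ∧
      Real.log (dist x y) ≤ Real.log ‖y‖ + -Real.log (1 - ρ / r) := by
  have hr0 : 0 < r := by linarith
  have hy0 : 0 < ‖y‖ := by linarith
  have hq : ρ / r < 1 := (div_lt_one hr0).2 (by linarith)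
  have hq0 : 0 ≤ ρ / r := by positivity
  have hρy : ρ ≤ ρ / r * ‖y‖ := by
    rw [div_mul_eq_mul_div, le_div_iff₀ hr0]
    gcongr
  have h1 : ‖y‖ - ρ ≤ dist x y := by
    rw [dist_comm, dist_eq_norm]
    linarith [norm_sub_norm_le y x]
  have h2 : dist x y ≤ ‖y‖ + ρ := by linarith [dist_le_norm_add_norm x y]
  have h3 : 1 ≤ dist x y := by linarith
  refine ⟨h3, ?_, ?_⟩
  · have : Real.log (‖y‖ * (1 - ρ / r)) ≤ Real.log (dist x y) :=
      Real.log_le_log (mul_pos hy0 (by linarith)) (by nlinarith)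
    rw [Real.log_mul hy0.ne' (by linarith)] at this
    linarith
  · rw [← sub_eq_add_neg, ← Real.log_div hy0.ne' (by linarith)]
    refine Real.log_le_log (by linarith) (h2.trans ?_)
    rw [le_div_iff₀ (by linarith)]
    nlinarith

theorem neg_logKernel_toENNReal_of_one_le {x y : EuclideanSpace ℝ (Fin n)} (h : 1 ≤ dist x y) :
    (-logKernel x y).toENNReal = ENNReal.ofReal (Real.log (dist x y)) := by
  rw [logKernel_of_ne (dist_pos.1 (by linarith)), ← EReal.coe_neg, neg_neg,
    EReal.real_coe_toENNReal]

theorem logKernel_toENNReal_of_one_le {x y : EuclideanSpace ℝ (Fin n)} (h : 1 ≤ dist x y) :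
    (logKernel x y).toENNReal = 0 := by
  rw [logKernel_of_ne (dist_pos.1 (by linarith)), EReal.real_coe_toENNReal,
    ENNReal.ofReal_eq_zero]
  linarith [Real.log_nonneg h]

theorem posEnergy_eq_zero_of_far {μ ν : Measure (EuclideanSpace ℝ (Fin n))} {ρ r : ℝ} (hρ : 0 ≤ ρ)
    (hr : ρ + 1 ≤ r) (hμ : ∀ᵐ x ∂μ, ‖x‖ ≤ ρ) (hν : ∀ᵐ y ∂ν, r ≤ ‖y‖) : posEnergy μ ν = 0 := by
  calc posEnergy μ ν = ∫⁻ _, ∫⁻ _, 0 ∂ν ∂μ := by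
        refine lintegral_congr_ae ?_
        filter_upwards [hμ] with x hx
        refine lintegral_congr_ae ?_
        filter_upwards [hν] with y hy
        exact logKernel_toENNReal_of_one_le (abs_log_dist_sub_log_norm_le hρ hr hx hy).1
    _ = 0 := by simp

/-- With its converse `negEnergy_le_logMoment_add`: up to the error term, the inner measure acts on
the outer one as a unit mass at the origin. -/
theorem logMoment_le_negEnergy_add {μ ν : Measure (EuclideanSpace ℝ (Fin n))}
    [IsProbabilityMeasure μ] [IsProbabilityMeasure ν] {ρ r : ℝ} (hρ : 0 ≤ ρ)
    (hr : ρ + 1 ≤ r) (hμ : ∀ᵐ x ∂μ, ‖x‖ ≤ ρ) (hν : ∀ᵐ y ∂ν, r ≤ ‖y‖) :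
    logMoment ν ≤ negEnergy μ ν + ENNReal.ofReal (-Real.log (1 - ρ / r)) := by
  calc logMoment ν = ∫⁻ _, logMoment ν ∂μ := by simp
    _ ≤ ∫⁻ x, ((∫⁻ y, (-logKernel x y).toENNReal ∂ν) +
          ENNReal.ofReal (-Real.log (1 - ρ / r))) ∂μ := by
        refine lintegral_mono_ae ?_
        filter_upwards [hμ] with x hx
        calc logMoment ν ≤ ∫⁻ y, ((-logKernel x y).toENNReal +
              ENNReal.ofReal (-Real.log (1 - ρ / r))) ∂ν := by
              refine lintegral_mono_ae ?_
              filter_upwards [hν] with y hy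
              obtain ⟨h1, h2, -⟩ := abs_log_dist_sub_log_norm_le hρ hr hx hy
              rw [neg_logKernel_toENNReal_of_one_le h1]
              exact (ENNReal.ofReal_le_ofReal h2).trans ENNReal.ofReal_add_le
          _ = _ := by
              rw [lintegral_add_right _ measurable_const]
              simp
    _ = _ := by
        rw [lintegral_add_right _ measurable_const]
        simp [negEnergy]

theorem negEnergy_le_logMoment_add {μ ν : Measure (EuclideanSpace ℝ (Fin n))}
    [IsProbabilityMeasure μ] [IsProbabilityMeasure ν] {ρ r : ℝ} (hρ : 0 ≤ ρ)
    (hr : ρ + 1 ≤ r) (hμ : ∀ᵐ x ∂μ, ‖x‖ ≤ ρ) (hν : ∀ᵐ y ∂ν, r ≤ ‖y‖) :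
    negEnergy μ ν ≤ logMoment ν + ENNReal.ofReal (-Real.log (1 - ρ / r)) := by
  calc negEnergy μ ν ≤ ∫⁻ _, (logMoment ν + ENNReal.ofReal (-Real.log (1 - ρ / r))) ∂μ := by
        refine lintegral_mono_ae ?_
        filter_upwards [hμ] with x hx
        calc _ ≤ ∫⁻ y, (ENNReal.ofReal (Real.log ‖y‖) +
              ENNReal.ofReal (-Real.log (1 - ρ / r))) ∂ν := by
              refine lintegral_mono_ae ?_
              filter_upwards [hν] with y hy
              obtain ⟨h1, -, h2⟩ := abs_log_dist_sub_log_norm_le hρ hr hx hy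
              rw [neg_logKernel_toENNReal_of_one_le h1]
              exact (ENNReal.ofReal_le_ofReal h2).trans ENNReal.ofReal_add_le
          _ = _ := by
              rw [lintegral_add_right _ measurable_const]
              simp [logMoment]
    _ = _ := by simp

theorem measurable_inversion : Measurable
    (EuclideanGeometry.inversion (0 : EuclideanSpace ℝ (Fin n)) 1) := by
  unfold EuclideanGeometry.inversion
  simp only [vsub_eq_sub, sub_zero, vadd_eq_add, add_zero]
  fun_prop

theorem dist_inversion_zero {y z : EuclideanSpace ℝ (Fin n)} (hy : y ≠ 0) (hz : z ≠ 0) :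
    dist (EuclideanGeometry.inversion 0 1 y) (EuclideanGeometry.inversion 0 1 z) =
      dist y z / (‖y‖ * ‖z‖) := by
  rw [EuclideanGeometry.dist_inversion_inversion hy hz]
  simp
  ring

/-- The reason inversion helps: integrated, the extra term ln|y| + ln|z| is the double moment
produced by the interaction with K. -/
theorem logKernel_inversion {y z : EuclideanSpace ℝ (Fin n)} (hy : y ≠ 0) (hz : z ≠ 0) :
    logKernel (EuclideanGeometry.inversion 0 1 y) (EuclideanGeometry.inversion 0 1 z) =
      logKernel y z + ((Real.log ‖y‖ + Real.log ‖z‖ : ℝ) : EReal) := by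
  rcases eq_or_ne y z with rfl | h
  · rw [logKernel_self, logKernel_self, EReal.top_add_coe]
  · have hd := dist_pos.2 h
    have hy' := norm_pos_iff.2 hy
    have hz' := norm_pos_iff.2 hz
    have h' : EuclideanGeometry.inversion 0 1 y ≠ EuclideanGeometry.inversion 0 1 z := by
      rw [← dist_pos, dist_inversion_zero hy hz]
      positivity
    rw [logKernel_of_ne h, logKernel_of_ne h', dist_inversion_zero hy hz, ← EReal.coe_add,
      Real.log_div hd.ne' (by positivity), Real.log_mul hy'.ne' hz'.ne']
    congr 1
    ring

/-- If both norms are at least 2, then |y − z| ≤ |y| + |z| ≤ |y||z|. This is the source of the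
condition r ≥ 2 below. -/
theorem logKernel_inversion_nonneg {y z : EuclideanSpace ℝ (Fin n)} (hy : 2 ≤ ‖y‖) (hz : 2 ≤ ‖z‖) :
    0 ≤ logKernel (EuclideanGeometry.inversion 0 1 y) (EuclideanGeometry.inversion 0 1 z) := by
  have hy0 : y ≠ 0 := norm_pos_iff.1 (by linarith)
  have hz0 : z ≠ 0 := norm_pos_iff.1 (by linarith)
  have : dist (EuclideanGeometry.inversion 0 1 y) (EuclideanGeometry.inversion 0 1 z) ≤ 1 := by
    rw [dist_inversion_zero hy0 hz0, div_le_one (by positivity)]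
    nlinarith [dist_le_norm_add_norm y z]
  simpa using neg_log_le_logKernel this

theorem lintegral_lintegral_log_norm {ν : Measure (EuclideanSpace ℝ (Fin n))}
    [IsProbabilityMeasure ν] :
    ∫⁻ y, ∫⁻ z, (ENNReal.ofReal (Real.log ‖y‖) + ENNReal.ofReal (Real.log ‖z‖)) ∂ν ∂ν =
      2 * logMoment ν := by
  have : ∀ y : EuclideanSpace ℝ (Fin n),
      ∫⁻ z, (ENNReal.ofReal (Real.log ‖y‖) + ENNReal.ofReal (Real.log ‖z‖)) ∂ν =
      ENNReal.ofReal (Real.log ‖y‖) + logMoment ν := fun y => by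
    rw [lintegral_add_left measurable_const, logMoment]
    simp
  simp only [this]
  rw [lintegral_add_right _ measurable_const, two_mul]
  simp [logMoment]

/-- Nonnegativity of the inverted kernel reads ln|y − z| ≤ ln|y| + ln|z|. Outer measures need not
have bounded support, so a finite moment is what controls their negative energy. -/
theorem negEnergy_self_le_logMoment {ν : Measure (EuclideanSpace ℝ (Fin n))}
    [IsProbabilityMeasure ν] (hν : ∀ᵐ y ∂ν, 2 ≤ ‖y‖) : negEnergy ν ν ≤ 2 * logMoment ν := by
  rw [← lintegral_lintegral_log_norm]
  refine lintegral_mono_ae ?_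
  filter_upwards [hν] with y hy
  refine lintegral_mono_ae ?_
  filter_upwards [hν] with z hz
  have h := logKernel_inversion_nonneg hy hz
  rw [logKernel_inversion (norm_pos_iff.1 (by linarith)) (norm_pos_iff.1 (by linarith))] at h
  rw [← ENNReal.ofReal_add (Real.log_nonneg (by linarith)) (Real.log_nonneg (by linarith)),
    ← EReal.real_coe_toENNReal]
  refine EReal.toENNReal_le_toENNReal ?_
  rw [EReal.neg_le, ← zero_sub]
  exact EReal.sub_le_of_le_add h

/-- The logarithmic energy of a measure and of its inversion. -/
theorem posEnergy_map_inversion {ν : Measure (EuclideanSpace ℝ (Fin n))}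
    [IsProbabilityMeasure ν] (hν : ∀ᵐ y ∂ν, 2 ≤ ‖y‖) :
    posEnergy (ν.map (EuclideanGeometry.inversion 0 1)) (ν.map (EuclideanGeometry.inversion 0 1)) +
      negEnergy ν ν = posEnergy ν ν + 2 * logMoment ν := by
  have mp : Measurable fun a : EReal => a.toENNReal := measurable_id.ereal_toENNReal
  have mn := measurable_neg_toENNReal
  have hinv := measurable_inversion (n := n)
  have hpush : posEnergy (ν.map (EuclideanGeometry.inversion 0 1))
      (ν.map (EuclideanGeometry.inversion 0 1)) =
      ∫⁻ y, ∫⁻ z, (logKernel (EuclideanGeometry.inversion 0 1 y)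
        (EuclideanGeometry.inversion 0 1 z)).toENNReal ∂ν ∂ν := by
    rw [posEnergy, lintegral_map (measurable_lintegral_logKernel mp _) hinv]
    exact lintegral_congr fun y => lintegral_map (mp.comp (measurable_logKernel_right _)) hinv
  rw [hpush, ← lintegral_lintegral_log_norm, negEnergy, posEnergy,
    ← lintegral_add_right _ (measurable_lintegral_logKernel mn _),
    ← lintegral_add_left (measurable_lintegral_logKernel mp _)]
  refine lintegral_congr_ae ?_
  filter_upwards [hν] with y hy
  rw [← lintegral_add_right (g := fun z => (-logKernel y z).toENNReal) _
      (mn.comp (measurable_logKernel_right y)),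
    ← lintegral_add_left (f := fun z => (logKernel y z).toENNReal)
      (mp.comp (measurable_logKernel_right y))]
  refine lintegral_congr_ae ?_
  filter_upwards [hν] with z hz
  have h := logKernel_inversion_nonneg hy hz
  have hly : 0 ≤ Real.log ‖y‖ := Real.log_nonneg (by linarith)
  have hlz : 0 ≤ Real.log ‖z‖ := Real.log_nonneg (by linarith)
  rw [logKernel_inversion (norm_pos_iff.1 (by linarith)) (norm_pos_iff.1 (by linarith))] at h ⊢
  have key := toENNReal_add_coe_add (logKernel y z) (Real.log ‖y‖ + Real.log ‖z‖)
  -- Both the inverted kernel and ln|y| + ln|z| are nonnegative, so their negative parts drop out of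
  -- `key`.
  rw [EReal.toENNReal_of_nonpos (x := -(_ + _)) (by rwa [EReal.neg_le, neg_zero]), zero_add,
    ENNReal.ofReal_of_nonpos (by linarith), add_zero, ENNReal.ofReal_add hly hlz] at key
  exact key

/-- The inverted measure lives in the ball of radius 1/r, which bounds its energy from below;
discarding the negative part only increases the energy. -/
theorem ballRobin_add_log_le_posEnergy {m : ℕ} {ν : Measure (EuclideanSpace ℝ (Fin (m + 2)))}
    [IsProbabilityMeasure ν] {r : ℝ} (hr : 2 ≤ r) (hν : ∀ᵐ y ∂ν, r ≤ ‖y‖) :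
    ((ballRobin m + Real.log r : ℝ) : EReal) ≤
      (posEnergy (ν.map (EuclideanGeometry.inversion 0 1))
        (ν.map (EuclideanGeometry.inversion 0 1)) : EReal) := by
  have hinv := measurable_inversion (n := m + 2)
  have : IsProbabilityMeasure (ν.map (EuclideanGeometry.inversion 0 1)) :=
    Measure.isProbabilityMeasure_map hinv.aemeasurable
  have hr0 : 0 < r := by linarith
  have hsupp : ∀ᵐ y ∂ν.map (EuclideanGeometry.inversion 0 1), ‖y‖ ≤ r⁻¹ := by
    rw [ae_map_iff hinv.aemeasurable (measurableSet_le measurable_norm measurable_const)]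
    filter_upwards [hν] with y hy
    rw [← dist_zero_right, EuclideanGeometry.dist_inversion_center, dist_zero_right, one_pow,
      one_div]
    exact inv_anti₀ hr0 hy
  have h := le_logEnergy_of_ae_norm_le (inv_pos.2 hr0) hsupp
  rw [Real.log_inv, sub_neg_eq_add] at h
  refine h.trans ?_
  rw [logEnergy]
  exact EReal.sub_le_of_le_add (le_add_of_nonneg_right (EReal.coe_ennreal_nonneg _))

theorem ae_norm_le_of_carried {μ : Measure (EuclideanSpace ℝ (Fin n))}
    {K : Set (EuclideanSpace ℝ (Fin n))} {ρ : ℝ} (hK : K ⊆ Metric.closedBall 0 ρ)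
    (hμ : μ Kᶜ = 0) : ∀ᵐ x ∂μ, ‖x‖ ≤ ρ := by
  filter_upwards [show K ∈ ae μ from hμ] with x hx
  simpa using hK hx

theorem coe_toReal_eq {a : ℝ≥0∞} (ha : a ≠ ⊤) : (a : EReal) = ((a.toReal : ℝ) : EReal) := by
  lift a to NNReal using ha
  rfl

/-- With Λ the logarithmic moment of νO and δ the error term: νK contributes at least `nrob K`, the
cross terms at least 2Λ − 2δ, and the self-energy of νO plus 2Λ is the inverted energy, at least
`ballRobin m` + ln r. The moment cancels. -/
theorem le_charge_energy {m : ℕ} {K : Set (EuclideanSpace ℝ (Fin (m + 2)))} {ρ r : ℝ}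
    (hρ : 0 ≤ ρ) (hK : K ⊆ Metric.closedBall 0 ρ) (hr : ρ + 1 ≤ r) (hr2 : 2 ≤ r)
    {νK νO : Measure (EuclideanSpace ℝ (Fin (m + 2)))} (h : IsCharge (Metric.ball 0 r) K νK νO) :
    nrob K + ((ballRobin m + Real.log r - 2 * -Real.log (1 - ρ / r) : ℝ) : EReal) ≤
      (signedPos νK νO : EReal) - (signedNeg νK νO : EReal) := by
  have := h.prob_inner
  have := h.prob_outer
  have hνK := ae_norm_le_of_carried hK h.carried_inner
  have hνO : ∀ᵐ y ∂νO, r ≤ ‖y‖ := by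
    filter_upwards [show (Metric.ball 0 r)ᶜ ∈ ae νO by
      rw [mem_ae_iff, compl_compl]; exact h.carried_outer] with y hy
    simpa using hy
  have hνO2 : ∀ᵐ y ∂νO, 2 ≤ ‖y‖ := hνO.mono fun y hy => hr2.trans hy
  have hbot : ∀ a : ℝ≥0∞, -(a : EReal) ≠ ⊤ := fun a => by
    rw [Ne, EReal.neg_eq_top_iff]
    exact EReal.coe_ennreal_ne_bot a
  -- If the positive part is infinite, the charge condition makes the negative part finite, and the
  -- energy is +∞.
  rcases eq_or_ne (signedPos νK νO) ⊤ with htop | hfin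
  · have hneg := h.defined.resolve_left (not_not.2 htop)
    rw [htop, coe_toReal_eq hneg]
    exact le_top
  · have hpKO := posEnergy_eq_zero_of_far hρ hr hνK hνO
    have hpOK : posEnergy νO νK = 0 := by rw [posEnergy_comm, hpKO]
    have hL1 := logMoment_le_negEnergy_add hρ hr hνK hνO
    have hL2 := hL1
    rw [negEnergy_comm] at hL2
    have hN := negEnergy_self_le_logMoment hνO2
    have hinv := posEnergy_map_inversion hνO2
    have hrob := ballRobin_add_log_le_posEnergy hr2 hνO
    have hbK : negEnergy νK νK ≠ ⊤ := ((negEnergy_le_of_dist_le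
      (ae_dist_le_of_ae_norm_le hνK hνK)).trans_lt ENNReal.ofReal_lt_top).ne
    have hδ : 0 ≤ -Real.log (1 - ρ / r) := by
      have : 0 ≤ ρ / r := by have : 0 < r := by linarith
                             positivity
      have : ρ / r < 1 := (div_lt_one (by linarith)).2 (by linarith)
      linarith [Real.log_nonpos (x := 1 - ρ / r) (by linarith) (by linarith)]
    have hnrob : nrob K ≤ logEnergy νK :=
      iInf_le_of_le νK (iInf_le_of_le h.prob_inner (iInf_le _ h.carried_inner))
    rw [logEnergy] at hnrob
    rw [signedPos] at hfin ⊢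
    rw [signedNeg, hpKO, hpOK, add_zero, add_zero]
    simp only [ENNReal.add_ne_top] at hfin
    obtain ⟨⟨⟨ha, hc⟩, he⟩, he'⟩ := hfin
    generalize posEnergy νK νK = a at *
    generalize negEnergy νK νK = b at *
    generalize posEnergy νO νO = c at *
    generalize negEnergy νO νO = d at *
    generalize negEnergy νK νO = e at *
    generalize negEnergy νO νK = e' at *
    generalize logMoment νO = Λ at *
    -- Finiteness propagates from the mutual energy to Λ, then to the negative energy of νO and to
    -- the inverted energy; what remains is real arithmetic.
    have hΛ : Λ ≠ ⊤ := (hL1.trans_lt (by finiteness)).ne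
    have hd : d ≠ ⊤ := (hN.trans_lt (by finiteness)).ne
    generalize posEnergy (νO.map (EuclideanGeometry.inversion 0 1))
      (νO.map (EuclideanGeometry.inversion 0 1)) = p at *
    have hp : p ≠ ⊤ := by
      have : p + d ≠ ⊤ := by rw [hinv]; finiteness
      exact (ENNReal.add_ne_top.1 this).1
    have r1 := ENNReal.toReal_mono (by finiteness) hL1
    have r2 := ENNReal.toReal_mono (by finiteness) hL2
    have r3 := congrArg ENNReal.toReal hinv
    rw [ENNReal.toReal_add (by finiteness) (by finiteness), ENNReal.toReal_ofReal hδ] at r1 r2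
    rw [ENNReal.toReal_add (by finiteness) (by finiteness), ENNReal.toReal_add (by finiteness)
      (by finiteness), ENNReal.toReal_mul, ENNReal.toReal_ofNat] at r3
    rw [coe_toReal_eq hp, EReal.coe_le_coe_iff] at hrob
    rw [coe_toReal_eq ha, coe_toReal_eq hbK, ← EReal.coe_sub] at hnrob
    rw [coe_toReal_eq (a := a + c + e + e') (by finiteness),
      coe_toReal_eq (a := b + d) (by finiteness), ← EReal.coe_sub,
      ENNReal.toReal_add (by finiteness) (by finiteness), ENNReal.toReal_add (by finiteness)
      (by finiteness), ENNReal.toReal_add (by finiteness) (by finiteness),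
      ENNReal.toReal_add (by finiteness) (by finiteness)]
    refine (add_le_add_left hnrob _).trans ?_
    rw [← EReal.coe_add, EReal.coe_le_coe_iff]
    linarith

theorem logMoment_sphereMeasure (hn : n ≠ 0) {r : ℝ} (hr : 0 < r) :
    logMoment (sphereMeasure n r) = ENNReal.ofReal (Real.log r) := by
  calc _ = ∫⁻ _, ENNReal.ofReal (Real.log r) ∂sphereMeasure n r := by
        refine lintegral_congr_ae ?_
        filter_upwards [ae_norm_eq_sphereMeasure hn hr] with y hy
        rw [hy]
    _ = _ := by simp

/-- The trial charge pairs μ with the uniform measure on |y| = r. The latter has energy `ballRobin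
m` − ln r and moment ln r, and the cross terms give at most 2 ln r + 2δ. -/
theorem nmd_le_logEnergy_add {m : ℕ} {K : Set (EuclideanSpace ℝ (Fin (m + 2)))} {ρ r : ℝ}
    (hρ : 0 ≤ ρ) (hK : K ⊆ Metric.closedBall 0 ρ) (hr : ρ + 1 ≤ r)
    {μ : Measure (EuclideanSpace ℝ (Fin (m + 2)))} [IsProbabilityMeasure μ] (hμ : μ Kᶜ = 0) :
    nmd (Metric.ball 0 r) K ≤ logEnergy μ +
      ((ballRobin m + Real.log r + 2 * -Real.log (1 - ρ / r) : ℝ) : EReal) := by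
  have hr0 : 0 < r := by linarith
  have hνK := ae_norm_le_of_carried hK hμ
  have hνeq := ae_norm_eq_sphereMeasure (Nat.succ_ne_zero (m + 1)) hr0
  have hνO : ∀ᵐ y ∂sphereMeasure (m + 2) r, r ≤ ‖y‖ := hνeq.mono fun y hy => hy.ge
  have hνO' : ∀ᵐ y ∂sphereMeasure (m + 2) r, ‖y‖ ≤ r := hνeq.mono fun y hy => hy.le
  have hpKO := posEnergy_eq_zero_of_far hρ hr hνK hνO
  have hpOK : posEnergy (sphereMeasure (m + 2) r) μ = 0 := by rw [posEnergy_comm, hpKO]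
  have hL1 := negEnergy_le_logMoment_add hρ hr hνK hνO
  rw [logMoment_sphereMeasure (Nat.succ_ne_zero (m + 1)) hr0] at hL1
  have hL2 := hL1
  rw [negEnergy_comm] at hL2
  have hbK : negEnergy μ μ ≠ ⊤ := ((negEnergy_le_of_dist_le
    (ae_dist_le_of_ae_norm_le hνK hνK)).trans_lt ENNReal.ofReal_lt_top).ne
  have hbO : negEnergy (sphereMeasure (m + 2) r) (sphereMeasure (m + 2) r) ≠ ⊤ :=
    ((negEnergy_le_of_dist_le
      (ae_dist_le_of_ae_norm_le hνO' hνO')).trans_lt ENNReal.ofReal_lt_top).ne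
  have hδ : 0 ≤ -Real.log (1 - ρ / r) := by
    have h1 : 0 ≤ ρ / r := by positivity
    have h2 : ρ / r < 1 := (div_lt_one (by linarith)).2 (by linarith)
    linarith [Real.log_nonpos (x := 1 - ρ / r) (by linarith) (by linarith)]
  have hlr : 0 ≤ Real.log r := Real.log_nonneg (by linarith)
  have hrob := logEnergy_sphereMeasure m hr0
  have hneg : signedNeg μ (sphereMeasure (m + 2) r) ≠ ⊤ := by
    rw [signedNeg, hpKO, hpOK]
    finiteness
  have hcharge : IsCharge (Metric.ball 0 r) K μ (sphereMeasure (m + 2) r) :=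
    { prob_inner := inferInstance
      prob_outer := inferInstance
      carried_inner := hμ
      carried_outer := by
        have : (Metric.ball 0 r)ᶜ ∈ ae (sphereMeasure (m + 2) r) := by
          filter_upwards [hνO] with y hy
          simpa using hy
        rwa [mem_ae_iff, compl_compl] at this
      defined := Or.inr hneg }
  refine (iInf_le_of_le μ (iInf_le_of_le (sphereMeasure (m + 2) r) (iInf_le _ hcharge))).trans ?_
  rw [logEnergy] at hrob ⊢
  rw [signedPos, signedNeg, hpKO, hpOK, add_zero, add_zero]
  generalize posEnergy μ μ = a at *
  generalize negEnergy μ μ = b at *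
  generalize posEnergy (sphereMeasure (m + 2) r) (sphereMeasure (m + 2) r) = c at *
  generalize negEnergy (sphereMeasure (m + 2) r) (sphereMeasure (m + 2) r) = d at *
  generalize negEnergy μ (sphereMeasure (m + 2) r) = e at *
  generalize negEnergy (sphereMeasure (m + 2) r) μ = e' at *
  rcases eq_or_ne a ⊤ with rfl | ha
  · rw [coe_toReal_eq hbK, EReal.coe_ennreal_top, EReal.top_sub_coe, EReal.top_add_coe]
    exact le_top
  · have he : e ≠ ⊤ := (hL1.trans_lt (by finiteness)).ne
    have he' : e' ≠ ⊤ := (hL2.trans_lt (by finiteness)).ne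
    have hc : c ≠ ⊤ := by
      rintro rfl
      rw [coe_toReal_eq hbO, EReal.coe_ennreal_top, EReal.top_sub_coe] at hrob
      exact EReal.coe_ne_top _ hrob.symm
    have r1 := ENNReal.toReal_mono (by finiteness) hL1
    have r2 := ENNReal.toReal_mono (by finiteness) hL2
    rw [ENNReal.toReal_add (by finiteness) (by finiteness), ENNReal.toReal_ofReal hδ,
      ENNReal.toReal_ofReal hlr] at r1 r2
    rw [coe_toReal_eq hc, coe_toReal_eq hbO, ← EReal.coe_sub, EReal.coe_eq_coe_iff] at hrob
    rw [coe_toReal_eq (a := a + c + e + e') (by finiteness),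
      coe_toReal_eq (a := b + d) (by finiteness), coe_toReal_eq ha, coe_toReal_eq hbK,
      ← EReal.coe_sub, ← EReal.coe_sub, ← EReal.coe_add, EReal.coe_le_coe_iff,
      ENNReal.toReal_add (by finiteness) (by finiteness), ENNReal.toReal_add (by finiteness)
      (by finiteness), ENNReal.toReal_add (by finiteness) (by finiteness),
      ENNReal.toReal_add (by finiteness) (by finiteness)]
    linarith

theorem tendsto_nmd_sub_log {m : ℕ} {K : Set (EuclideanSpace ℝ (Fin (m + 2)))} (hK : IsCompact K) :
    Tendsto (fun r : ℝ => nmd (Metric.ball (0 : EuclideanSpace ℝ (Fin (m + 2))) r) K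
      - (Real.log r : EReal)) atTop (𝓝 (nrob K + (ballRobin m : EReal))) := by
  obtain ⟨ρ, hρ, hKρ⟩ : ∃ ρ : ℝ, 0 ≤ ρ ∧ K ⊆ Metric.closedBall 0 ρ := by
    obtain ⟨ρ, h⟩ := hK.isBounded.subset_closedBall 0
    exact ⟨max ρ 0, le_max_right _ _, h.trans (Metric.closedBall_subset_closedBall (le_max_left _ _))⟩
  have hδ : Tendsto (fun r : ℝ => -Real.log (1 - ρ / r)) atTop (𝓝 0) := by
    have h1 : Tendsto (fun r : ℝ => 1 - ρ / r) atTop (𝓝 (1 - 0)) :=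
      tendsto_const_nhds.sub (tendsto_const_nhds.div_atTop tendsto_id)
    have h2 := ((Real.continuousAt_log (by norm_num)).tendsto.comp h1).neg
    simpa using h2
  -- The values s = ∓2 are the lower and upper bounds of the squeeze. `nrob K` may be +∞, for
  -- instance for empty K; adding finite terms is still continuous there.
  have hlim : ∀ s : ℝ, Tendsto (fun r : ℝ => nrob K +
      ((ballRobin m + s * -Real.log (1 - ρ / r) : ℝ) : EReal)) atTop
      (𝓝 (nrob K + (ballRobin m : EReal))) := by
    intro s
    have h1 : Tendsto (fun r : ℝ => ((ballRobin m + s * -Real.log (1 - ρ / r) : ℝ) : EReal)) atTop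
        (𝓝 (ballRobin m : EReal)) := by
      refine (continuous_coe_real_ereal.tendsto _).comp ?_
      simpa using (hδ.const_mul s).const_add (ballRobin m)
    exact (EReal.continuousAt_add (p := (nrob K, (ballRobin m : EReal))) (Or.inr (EReal.coe_ne_bot _))
      (Or.inr (EReal.coe_ne_top _))).tendsto.comp (tendsto_const_nhds.prodMk_nhds h1)
  have hsub : ∀ (A : EReal) (a l : ℝ), A + ((a + l : ℝ) : EReal) - (l : EReal) = A + (a : EReal) := by
    intro A a l
    rw [EReal.coe_add, sub_eq_add_neg, add_assoc, add_assoc, ← EReal.coe_neg, ← EReal.coe_add,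
      add_neg_cancel, EReal.coe_zero, add_zero]
  refine tendsto_of_tendsto_of_tendsto_of_le_of_le' (hlim (-2)) (hlim 2) ?_ ?_
  · filter_upwards [eventually_ge_atTop (ρ + 1), eventually_ge_atTop 2] with r hr hr2
    rw [← hsub (nrob K) _ (Real.log r)]
    refine EReal.sub_le_sub (le_iInf fun νK => le_iInf fun νO => le_iInf fun hc => ?_) le_rfl
    refine le_trans (le_of_eq ?_) (le_charge_energy hρ hKρ hr hr2 hc)
    congr 2
    ring
  · filter_upwards [eventually_ge_atTop (ρ + 1)] with r hr
    rw [← hsub (nrob K) _ (Real.log r)]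
    refine EReal.sub_le_sub ?_ le_rfl
    rw [← EReal.sub_le_iff_le_add (Or.inl (EReal.coe_ne_bot _)) (Or.inl (EReal.coe_ne_top _))]
    refine le_iInf fun μ => le_iInf fun hp => le_iInf fun hμ => ?_
    rw [EReal.sub_le_iff_le_add (Or.inl (EReal.coe_ne_bot _)) (Or.inl (EReal.coe_ne_top _))]
    refine (nmd_le_logEnergy_add hρ hKρ hr hμ).trans (le_of_eq ?_)
    rw [logEnergy]
    congr 2
    ring

theorem ncap3_eq_exp_div {m : ℕ} (K : Set (EuclideanSpace ℝ (Fin (m + 2)))) :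
    ncap3 K = EReal.exp (-(nrob K + (ballRobin m : EReal))) /
      ncap3 (Metric.closedBall (0 : EuclideanSpace ℝ (Fin (m + 2))) 1) := by
  have hpos : ENNReal.ofReal (Real.exp (-ballRobin m)) ≠ 0 := by
    simp [Real.exp_pos]
  rw [ncap3_closedBall m one_pos, one_mul, EReal.neg_add (Or.inr (EReal.coe_ne_top _))
    (Or.inr (EReal.coe_ne_bot _)), sub_eq_add_neg, EReal.exp_add, ← EReal.coe_neg, EReal.exp_coe,
    ENNReal.mul_div_cancel_right hpos ENNReal.ofReal_ne_top, ncap3]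

end TransfiniteModulus

end ConformalCapacity

namespace ConformalCapacity

open Set

/-! ### Coordinate lines: Fubini and derivatives -/

section Lines

variable {n : ℕ}

theorem linePoint_apply_self (i : Fin n) (y : {j : Fin n // j ≠ i} → ℝ) (t : ℝ) :
    linePoint i y t i = t := by
  simp [linePoint]

theorem linePoint_add (i : Fin n) (y : {j : Fin n // j ≠ i} → ℝ) (t s : ℝ) :
    linePoint i y (t + s) = linePoint i y t + s • EuclideanSpace.single i 1 := by
  ext j
  by_cases h : j = i
  · subst h; simp [linePoint]
  · simp [linePoint, h]

theorem lineDeriv_linePoint (u : EuclideanSpace ℝ (Fin n) → ℝ) (i : Fin n)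
    (y : {j : Fin n // j ≠ i} → ℝ) (t : ℝ) :
    lineDeriv ℝ u (linePoint i y t) (EuclideanSpace.single i 1) =
      deriv (fun t => u (linePoint i y t)) t := by
  simp only [lineDeriv, ← linePoint_add]
  simpa using deriv_comp_const_add (f := fun t => u (linePoint i y t)) t 0

theorem lipschitzWith_linePoint (i : Fin n) (y : {j : Fin n // j ≠ i} → ℝ) :
    LipschitzWith 1 (linePoint i y) := by
  refine LipschitzWith.of_dist_le_mul fun s t => ?_
  have : linePoint i y s = linePoint i y t + (s - t) • EuclideanSpace.single i 1 := by
    rw [← linePoint_add, add_sub_cancel]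
  rw [this, dist_self_add_left, norm_smul, Real.dist_eq]
  simp

/-- Fubini's theorem for lines parallel to a coordinate axis. -/
theorem measurePreserving_linePoint (i : Fin n) :
    MeasurePreserving (fun p : ℝ × ({j : Fin n // j ≠ i} → ℝ) => linePoint i p.2 p.1)
      volume volume := by
  have h1 : MeasurePreserving (MeasurableEquiv.funUnique {j : Fin n // j = i} ℝ).symm
      volume volume := by
    convert! (volume_preserving_funUnique {j : Fin n // j = i} ℝ).symm
  have h2 := h1.prod (MeasurePreserving.id (volume : Measure ({j : Fin n // ¬ j = i} → ℝ)))
  have h3 : MeasurePreserving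
      (MeasurableEquiv.piEquivPiSubtypeProd (fun _ : Fin n => ℝ) (fun j => j = i)).symm
      (volume.prod volume) volume := by
    convert! (volume_preserving_piEquivPiSubtypeProd (fun _ : Fin n => ℝ) (fun j => j = i)).symm
    rw [Measure.volume_eq_prod]
    congr!
  have h4 := (PiLp.volume_preserving_toLp (Fin n)).comp (h3.comp h2)
  convert! h4 using 1

theorem integral_eq_integral_lines (i : Fin n) {g : EuclideanSpace ℝ (Fin n) → ℝ}
    (hg : Integrable g) :
    ∫ x, g x = ∫ y : ({j : Fin n // j ≠ i} → ℝ), ∫ t : ℝ, g (linePoint i y t) := by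
  have hmp := measurePreserving_linePoint i
  have hi := (hmp.integrable_comp hg.aestronglyMeasurable).2 hg
  rw [← hmp.map_eq, integral_map hmp.measurable.aemeasurable (by
    rw [hmp.map_eq]; exact hg.aestronglyMeasurable), Measure.volume_eq_prod]
  exact integral_prod_symm _ hi

theorem hasDerivAt_norm_line {x : EuclideanSpace ℝ (Fin n)} (hx : x ≠ 0) (i : Fin n) :
    HasDerivAt (fun t : ℝ => ‖x + t • EuclideanSpace.single i (1 : ℝ)‖) (x i / ‖x‖) 0 := by
  have h1 : HasDerivAt (fun t : ℝ => x + t • EuclideanSpace.single i (1 : ℝ))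
      (EuclideanSpace.single i (1 : ℝ)) 0 := by
    simpa using ((hasDerivAt_id (0 : ℝ)).smul_const (EuclideanSpace.single i (1 : ℝ))).const_add x
  have h2 := h1.norm_sq.sqrt (by simpa using hx)
  simp only [zero_smul, add_zero, Real.sqrt_sq (norm_nonneg _)] at h2
  refine h2.congr_deriv ?_
  rw [EuclideanSpace.inner_single_right]
  simp
  field_simp

theorem eventually_norm_line {x : EuclideanSpace ℝ (Fin n)} (i : Fin n) {s : Set ℝ} (hs : IsOpen s)
    (hx : ‖x‖ ∈ s) : ∀ᶠ t : ℝ in 𝓝 0, ‖x + t • EuclideanSpace.single i (1 : ℝ)‖ ∈ s := by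
  have hc : Continuous fun t : ℝ => ‖x + t • EuclideanSpace.single i (1 : ℝ)‖ := by fun_prop
  exact hc.continuousAt.eventually (hs.mem_nhds (by simpa using hx))

theorem AbsolutelyContinuousOnInterval.pow {f : ℝ → ℝ} {a b : ℝ}
    (hf : AbsolutelyContinuousOnInterval f a b) (k : ℕ) :
    AbsolutelyContinuousOnInterval (fun t => f t ^ k) a b := by
  induction k with
  | zero =>
    simp only [pow_zero]
    exact ((LipschitzWith.const (1 : ℝ)).lipschitzOnWith).absolutelyContinuousOnInterval
  | succ k ih =>
    simp only [pow_succ]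
    exact ih.mul hf

end Lines

/-! ### The radial field x · max(|x|, r)^{-n} and its divergence -/

section RadialField

variable {n : ℕ}

/-- The radial weight `max(|x|, r)^{-n}`. -/
noncomputable def radialWeight (r : ℝ) (x : EuclideanSpace ℝ (Fin n)) : ℝ := (max ‖x‖ r)⁻¹ ^ n

theorem continuous_radialWeight {r : ℝ} (hr : 0 < r) :
    Continuous (radialWeight r : EuclideanSpace ℝ (Fin n) → ℝ) := by
  unfold radialWeight
  exact ((continuous_norm.max continuous_const).inv₀ fun x => (lt_max_of_lt_right hr).ne').pow n

theorem lipschitzWith_inv_max {r : ℝ} (hr : 0 < r) :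
    LipschitzWith (Real.toNNReal (r ^ 2)⁻¹)
      fun x : EuclideanSpace ℝ (Fin n) => (max ‖x‖ r)⁻¹ := by
  refine LipschitzWith.of_dist_le_mul fun x y => ?_
  have hx : r ≤ max ‖x‖ r := le_max_right _ _
  have hy : r ≤ max ‖y‖ r := le_max_right _ _
  have hmax : |max ‖y‖ r - max ‖x‖ r| ≤ dist x y := by
    refine (abs_max_sub_max_le_abs _ _ _).trans ?_
    rw [dist_comm, dist_eq_norm]
    exact abs_norm_sub_norm_le y x
  have h0 : 0 < max ‖x‖ r * max ‖y‖ r := mul_pos (hr.trans_le hx) (hr.trans_le hy)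
  rw [Real.coe_toNNReal _ (by positivity), Real.dist_eq,
    inv_sub_inv (hr.trans_le hx).ne' (hr.trans_le hy).ne', abs_div, abs_of_pos h0, inv_mul_eq_div]
  gcongr
  nlinarith

/-- Truncation at r removes the singularity at the origin, so integration by parts works on every
line, including those through the origin. -/
theorem absolutelyContinuousOnInterval_radialWeight {r : ℝ} (hr : 0 < r) (i : Fin n)
    (y : {j : Fin n // j ≠ i} → ℝ) (a b : ℝ) :
    AbsolutelyContinuousOnInterval (fun t => t * radialWeight r (linePoint i y t)) a b := by
  have h1 : AbsolutelyContinuousOnInterval (fun t => (max ‖linePoint i y t‖ r)⁻¹) a b :=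
    (((lipschitzWith_inv_max hr).comp
      (lipschitzWith_linePoint i y)).lipschitzOnWith).absolutelyContinuousOnInterval
  have h2 : AbsolutelyContinuousOnInterval (fun t : ℝ => t) a b :=
    (LipschitzWith.id.lipschitzOnWith).absolutelyContinuousOnInterval
  exact h2.mul (AbsolutelyContinuousOnInterval.pow h1 n)

theorem lineDeriv_radialField_of_lt {r : ℝ} {x : EuclideanSpace ℝ (Fin n)} (hx : ‖x‖ < r)
    (i : Fin n) :
    lineDeriv ℝ (fun x : EuclideanSpace ℝ (Fin n) => x i * radialWeight r x) x
      (EuclideanSpace.single i 1) = r⁻¹ ^ n := by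
  have h1 : HasDerivAt (fun t : ℝ => (x i + t) * r⁻¹ ^ n) (r⁻¹ ^ n) 0 := by
    simpa using ((hasDerivAt_id (0 : ℝ)).const_add (x i)).mul_const (r⁻¹ ^ n)
  refine (h1.congr_of_eventuallyEq ?_).deriv
  filter_upwards [eventually_norm_line i isOpen_Iio hx] with t ht
  simp only [radialWeight, max_eq_right (mem_Iio.1 ht).le]
  simp

theorem lineDeriv_radialField_of_gt {r : ℝ} {x : EuclideanSpace ℝ (Fin n)} (hr : 0 < r)
    (hx : r < ‖x‖) (i : Fin n) :
    lineDeriv ℝ (fun x : EuclideanSpace ℝ (Fin n) => x i * radialWeight r x) x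
      (EuclideanSpace.single i 1) = ‖x‖⁻¹ ^ n * (1 - n * x i ^ 2 / ‖x‖ ^ 2) := by
  have hx0 : 0 < ‖x‖ := hr.trans hx
  have hN := (hasDerivAt_norm_line (norm_pos_iff.1 hx0) i).inv (by simpa using hx0.ne')
  have h1 := ((hasDerivAt_id (0 : ℝ)).const_add (x i)).mul (hN.pow n)
  have h2 := (h1.congr_of_eventuallyEq (f₁ := fun t : ℝ =>
    (x + t • EuclideanSpace.single i (1 : ℝ)) i *
      radialWeight r (x + t • EuclideanSpace.single i (1 : ℝ))) ?_).deriv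
  · refine h2.trans ?_
    rcases n with _ | k
    · exact i.elim0
    · simp
      field_simp
      ring
  · filter_upwards [eventually_norm_line i isOpen_Ioi hx] with t ht
    simp only [radialWeight, max_eq_left (mem_Ioi.1 ht).le]
    simp

/-- Outside the ball x|x|^{-n} is divergence free; inside, the field is linear. The divergence thus
sits where an admissible function vanishes, which makes the flux independent of u. -/
theorem sum_lineDeriv_radialField {r : ℝ} {x : EuclideanSpace ℝ (Fin n)} (hr : 0 < r)
    (hx : ‖x‖ ≠ r) :
    ∑ i, lineDeriv ℝ (fun x : EuclideanSpace ℝ (Fin n) => x i * radialWeight r x) x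
      (EuclideanSpace.single i 1) = (Metric.ball 0 r).indicator (fun _ => n * r⁻¹ ^ n) x := by
  rcases lt_or_gt_of_ne hx with h | h
  · simp [lineDeriv_radialField_of_lt h, h]
  · have hx0 : 0 < ‖x‖ := hr.trans h
    have hsum : ∑ i, x i ^ 2 = ‖x‖ ^ 2 := by
      rw [EuclideanSpace.norm_sq_eq]; simp
    simp only [lineDeriv_radialField_of_gt hr h]
    rw [← Finset.mul_sum, Finset.sum_sub_distrib, ← Finset.sum_div, ← Finset.mul_sum, hsum,
      indicator_of_notMem (by simpa using h.le)]
    simp [hx0.ne']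

theorem abs_lineDeriv_radialField_le {r : ℝ} {x : EuclideanSpace ℝ (Fin n)} (hr : 0 < r)
    (hx : ‖x‖ ≠ r) (i : Fin n) :
    ‖lineDeriv ℝ (fun x : EuclideanSpace ℝ (Fin n) => x i * radialWeight r x) x
      (EuclideanSpace.single i 1)‖ ≤ r⁻¹ ^ n * (1 + n) := by
  rcases lt_or_gt_of_ne hx with h | h
  · rw [lineDeriv_radialField_of_lt h, Real.norm_of_nonneg (by positivity)]
    exact le_mul_of_one_le_right (by positivity) (by simp)
  · have hx0 : 0 < ‖x‖ := hr.trans h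
    rw [lineDeriv_radialField_of_gt hr h, norm_mul, Real.norm_of_nonneg (by positivity)]
    have hxi : x i ^ 2 / ‖x‖ ^ 2 ≤ 1 := by
      rw [div_le_one (by positivity), sq_le_sq, abs_norm]
      simpa using PiLp.norm_apply_le x i
    have hxi0 : 0 ≤ x i ^ 2 / ‖x‖ ^ 2 := by positivity
    gcongr
    rw [Real.norm_eq_abs, abs_le, mul_div_assoc]
    constructor <;> nlinarith [(Nat.cast_nonneg n : (0 : ℝ) ≤ n)]

end RadialField

/-! ### Lower bound for the capacity of a spherical ring -/

section LowerBound

variable {n : ℕ} {u : EuclideanSpace ℝ (Fin n) → ℝ} {r R : ℝ}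

theorem measurable_gradNorm (hu : Continuous u) : Measurable (gradNorm u) := by
  unfold gradNorm
  exact (Finset.measurable_sum _ fun i _ => (measurable_lineDeriv hu).pow_const 2).sqrt

theorem gradNorm_nonneg (u : EuclideanSpace ℝ (Fin n) → ℝ) (x : EuclideanSpace ℝ (Fin n)) :
    0 ≤ gradNorm u x := Real.sqrt_nonneg _

theorem abs_lineDeriv_le_gradNorm (u : EuclideanSpace ℝ (Fin n) → ℝ) (x : EuclideanSpace ℝ (Fin n))
    (i : Fin n) : |lineDeriv ℝ u x (EuclideanSpace.single i 1)| ≤ gradNorm u x := by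
  rw [gradNorm, ← Real.sqrt_sq_eq_abs]
  exact Real.sqrt_le_sqrt (Finset.single_le_sum
    (f := fun i => lineDeriv ℝ u x (EuclideanSpace.single i 1) ^ 2)
    (fun j _ => sq_nonneg _) (Finset.mem_univ i))

theorem lineDeriv_eq_zero_of_eventually_const {x v : EuclideanSpace ℝ (Fin n)} {c : ℝ}
    (h : ∀ᶠ z in 𝓝 x, u z = c) : lineDeriv ℝ u x v = 0 := by
  have : (fun t : ℝ => u (x + t • v)) =ᶠ[𝓝 0] fun _ => c := by
    have hc : ContinuousAt (fun t : ℝ => x + t • v) 0 := by fun_prop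
    exact hc.eventually (by simpa using h)
  rw [lineDeriv, this.deriv_eq, deriv_const]

theorem gradNorm_eq_zero_of_eventually_const {x : EuclideanSpace ℝ (Fin n)} {c : ℝ}
    (h : ∀ᶠ z in 𝓝 x, u z = c) : gradNorm u x = 0 := by
  simp [gradNorm, lineDeriv_eq_zero_of_eventually_const h]

/-- Because the closure of {u < 1} lies in the open ball, u is 1 near every such point, even on the
sphere |x| = R; derivatives therefore vanish there too. -/
theorem IsAdmissible.eventually_eq_one (hu : IsAdmissible (Metric.ball 0 R) (Metric.closedBall 0 r) u)
    {x : EuclideanSpace ℝ (Fin n)} (hx : R ≤ ‖x‖) : ∀ᶠ z in 𝓝 x, u z = 1 := by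
  have : x ∈ (closure {x | 0 ≤ u x ∧ u x < 1})ᶜ := fun h => by
    have := hu.closure_subset h
    simp at this
    linarith
  filter_upwards [isClosed_closure.isOpen_compl.mem_nhds this] with z hz
  refine le_antisymm (hu.le_one z) (not_lt.1 fun h => hz (subset_closure ⟨hu.nonneg z, h⟩))

theorem IsAdmissible.eventually_eq_zero
    (hu : IsAdmissible (Metric.ball 0 R) (Metric.closedBall 0 r) u)
    {x : EuclideanSpace ℝ (Fin n)} (hx : ‖x‖ < r) : ∀ᶠ z in 𝓝 x, u z = 0 := by
  filter_upwards [Metric.isOpen_ball.mem_nhds (show x ∈ Metric.ball 0 r by simpa using hx)] with z hz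
  exact hu.eq_zero z (Metric.ball_subset_closedBall hz)

theorem IsAdmissible.gradNorm_eq_zero
    (hu : IsAdmissible (Metric.ball 0 R) (Metric.closedBall 0 r) u)
    {x : EuclideanSpace ℝ (Fin n)} (hx : ‖x‖ < r ∨ R ≤ ‖x‖) : gradNorm u x = 0 := by
  rcases hx with h | h
  · exact gradNorm_eq_zero_of_eventually_const (hu.eventually_eq_zero h)
  · exact gradNorm_eq_zero_of_eventually_const (hu.eventually_eq_one h)

theorem ae_norm_ne (hn : n ≠ 0) (r : ℝ) : ∀ᵐ x : EuclideanSpace ℝ (Fin n), ‖x‖ ≠ r := by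
  have : Nonempty (Fin n) := ⟨⟨0, Nat.pos_of_ne_zero hn⟩⟩
  have h := Measure.addHaar_sphere volume (0 : EuclideanSpace ℝ (Fin n)) r
  rw [ae_iff]
  convert h using 2
  ext x
  simp

/-- Integration by parts against the radial field on a line parallel to a coordinate axis. -/
theorem integral_line_mul_radialField (hr : 0 < r)
    (hu : IsAdmissible (Metric.ball 0 R) (Metric.closedBall 0 r) u) (i : Fin n)
    {y : {j : Fin n // j ≠ i} → ℝ}
    (hy : ∀ a b : ℝ, AbsolutelyContinuousOnInterval (fun t => u (linePoint i y t)) a b) :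
    ∫ t : ℝ, lineDeriv ℝ u (linePoint i y t) (EuclideanSpace.single i 1) *
        (linePoint i y t i * radialWeight r (linePoint i y t)) =
      ∫ t : ℝ, (1 - u (linePoint i y t)) *
        lineDeriv ℝ (fun x : EuclideanSpace ℝ (Fin n) => x i * radialWeight r x) (linePoint i y t)
          (EuclideanSpace.single i 1) := by
  have hnorm : ∀ t : ℝ, t ∉ Ioo (-R) R → R ≤ ‖linePoint i y t‖ := fun t ht => by
    have h1 : R ≤ |t| := by
      by_contra hc
      exact ht (abs_lt.1 (not_le.1 hc))
    have h2 := PiLp.norm_apply_le (linePoint i y t) i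
    rw [linePoint_apply_self, Real.norm_eq_abs] at h2
    exact h1.trans h2
  have hone : ∀ t : ℝ, t ∉ Ioo (-R) R → u (linePoint i y t) = 1 := fun t ht =>
    (hu.eventually_eq_one (hnorm t ht)).self_of_nhds
  have hzero : ∀ t : ℝ, t ∉ Ioo (-R) R →
      lineDeriv ℝ u (linePoint i y t) (EuclideanSpace.single i 1) = 0 := fun t ht =>
    lineDeriv_eq_zero_of_eventually_const (hu.eventually_eq_one (hnorm t ht))
  have hsupp : ∀ {g : ℝ → ℝ}, (∀ t, t ∉ Ioo (-R) R → g t = 0) →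
      ∫ t in (-R)..R, g t = ∫ t, g t := fun {g} hg =>
    intervalIntegral.integral_eq_integral_of_support_subset fun t ht =>
      Ioo_subset_Ioc_self (by_contra fun h => ht (hg t h))
  rw [← hsupp fun t ht => by rw [hzero t ht, zero_mul],
    ← hsupp fun t ht => by rw [hone t ht, sub_self, zero_mul]]
  -- Using 1 − u rather than u removes the boundary terms, since it vanishes at t = ±R.
  have hW : AbsolutelyContinuousOnInterval (fun t => 1 - u (linePoint i y t)) (-R) R :=
    (((LipschitzWith.const (1 : ℝ)).lipschitzOnWith).absolutelyContinuousOnInterval).sub (hy _ _)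
  have hparts := hW.integral_mul_deriv_eq_deriv_mul
    (absolutelyContinuousOnInterval_radialWeight hr i y (-R) R)
  rw [hone R (by simp), hone (-R) (by simp), sub_self, zero_mul, zero_mul, sub_self, zero_sub,
    ← intervalIntegral.integral_neg] at hparts
  simp only [lineDeriv_linePoint, linePoint_apply_self]
  rw [hparts]
  refine intervalIntegral.integral_congr fun t _ => ?_
  simp only [deriv_const_sub]
  ring

/-- The flux of the radial field through the level sets of an admissible function. -/
theorem integral_grad_mul_radialField (hn : n ≠ 0) (hr : 0 < r)
    (hu : IsAdmissible (Metric.ball 0 R) (Metric.closedBall 0 r) u)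
    (hint : ∀ i : Fin n, Integrable fun x => lineDeriv ℝ u x (EuclideanSpace.single i 1) *
      (x i * radialWeight r x)) :
    ∫ x, ∑ i : Fin n, lineDeriv ℝ u x (EuclideanSpace.single i 1) * (x i * radialWeight r x) =
      n * (volume (Metric.ball (0 : EuclideanSpace ℝ (Fin n)) 1)).toReal := by
  have hcF : ∀ i : Fin n, Continuous fun x : EuclideanSpace ℝ (Fin n) => x i * radialWeight r x :=
    fun i => (by fun_prop : Continuous fun x : EuclideanSpace ℝ (Fin n) => x i).mul
      (continuous_radialWeight hr)
  have hint2 : ∀ i : Fin n, Integrable fun x => (1 - u x) *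
      lineDeriv ℝ (fun x : EuclideanSpace ℝ (Fin n) => x i * radialWeight r x) x
        (EuclideanSpace.single i 1) := by
    intro i
    have hsupp : HasCompactSupport fun x => 1 - u x := by
      refine HasCompactSupport.intro (isCompact_closedBall (0 : EuclideanSpace ℝ (Fin n)) R)
        fun x hx => ?_
      rw [(hu.eventually_eq_one (by simpa using (not_le.1 (by simpa using hx)).le)).self_of_nhds, sub_self]
    have h1 : Integrable fun x => 1 - u x :=
      (continuous_const.sub hu.continuous).integrable_of_hasCompactSupport hsupp
    refine h1.mul_bdd (c := r⁻¹ ^ n * (1 + n)) (measurable_lineDeriv (hcF i)).aestronglyMeasurable ?_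
    filter_upwards [ae_norm_ne hn r] with x hx using abs_lineDeriv_radialField_le hr hx i
  calc _ = ∑ i : Fin n, ∫ x, lineDeriv ℝ u x (EuclideanSpace.single i 1) *
        (x i * radialWeight r x) := integral_finsetSum _ fun i _ => hint i
    _ = ∑ i : Fin n, ∫ x, (1 - u x) *
        lineDeriv ℝ (fun x : EuclideanSpace ℝ (Fin n) => x i * radialWeight r x) x
          (EuclideanSpace.single i 1) := by
        refine Finset.sum_congr rfl fun i _ => ?_
        rw [integral_eq_integral_lines i (hint i), integral_eq_integral_lines i (hint2 i)]
        refine integral_congr_ae ?_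
        filter_upwards [hu.acl i] with y hy
        exact integral_line_mul_radialField hr hu i hy
    _ = ∫ x, ∑ i : Fin n, (1 - u x) *
        lineDeriv ℝ (fun x : EuclideanSpace ℝ (Fin n) => x i * radialWeight r x) x
          (EuclideanSpace.single i 1) := (integral_finsetSum _ fun i _ => hint2 i).symm
    _ = ∫ x, (Metric.ball (0 : EuclideanSpace ℝ (Fin n)) r).indicator (fun _ => n * r⁻¹ ^ n) x := by
        refine integral_congr_ae ?_
        filter_upwards [ae_norm_ne hn r] with x hx
        rw [← Finset.mul_sum, sum_lineDeriv_radialField hr hx]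
        by_cases h : x ∈ Metric.ball (0 : EuclideanSpace ℝ (Fin n)) r
        · rw [hu.eq_zero x (Metric.ball_subset_closedBall h), sub_zero, one_mul]
        · rw [indicator_of_notMem h, mul_zero]
    _ = _ := by
        rw [integral_indicator measurableSet_ball, setIntegral_const, smul_eq_mul, Measure.real,
          Measure.addHaar_ball_of_pos _ _ hr, ENNReal.toReal_mul,
          ENNReal.toReal_ofReal (by positivity), finrank_euclideanSpace_fin, inv_pow]
        field_simp

theorem lintegral_inv_norm_pow (hn : n ≠ 0) (hr : 0 < r) (hrR : r ≤ R) :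
    ∫⁻ x in {x : EuclideanSpace ℝ (Fin n) | ‖x‖ ∈ Ioo r R}, ENNReal.ofReal (‖x‖⁻¹ ^ n) =
      n * volume (Metric.ball (0 : EuclideanSpace ℝ (Fin n)) 1) *
        ENNReal.ofReal (Real.log (R / r)) := by
  have : Nontrivial (EuclideanSpace ℝ (Fin n)) := by
    have : Nonempty (Fin n) := ⟨⟨0, Nat.pos_of_ne_zero hn⟩⟩
    infer_instance
  have hms : MeasurableSet {x : EuclideanSpace ℝ (Fin n) | ‖x‖ ∈ Ioo r R} :=
    measurable_norm measurableSet_Ioo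
  rw [← lintegral_indicator hms]
  have h := lintegral_fun_norm (volume : Measure (EuclideanSpace ℝ (Fin n)))
    (f := (Ioo r R).indicator fun s => ENNReal.ofReal (s⁻¹ ^ n))
    (Measurable.indicator (by fun_prop) measurableSet_Ioo)
  rw [finrank_euclideanSpace_fin] at h
  refine Eq.trans (lintegral_congr fun x => ?_) (h.trans ?_)
  · simp [indicator]
  · congr 1
    rw [← lintegral_inv_Ioo hr hrR]
    calc _ = ∫⁻ s in Ioi (0 : ℝ), (Ioo r R).indicator (fun s => ENNReal.ofReal s⁻¹) s := by
          refine setLIntegral_congr_fun measurableSet_Ioi fun s (hs : 0 < s) => ?_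
          by_cases h : s ∈ Ioo r R
          · simp only [indicator_of_mem h]
            rw [← ENNReal.ofReal_mul (by positivity)]
            congr 1
            obtain ⟨k, rfl⟩ := Nat.exists_eq_succ_of_ne_zero hn
            simp only [Nat.succ_eq_add_one, Nat.add_sub_cancel, inv_pow]
            field_simp
            ring
          · simp [indicator_of_notMem h]
      _ = _ := by
          rw [setLIntegral_indicator measurableSet_Ioo,
            inter_eq_left.2 (Ioo_subset_Ioi_self.trans (Ioi_subset_Ioi hr.le))]

/-- The lower bound for the conformal capacity of a spherical ring. -/
theorem IsAdmissible.le_lintegral_gradNorm (hn : 2 ≤ n) (hr : 0 < r) (hrR : r < R)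
    (hu : IsAdmissible (Metric.ball 0 R) (Metric.closedBall 0 r) u) :
    n * volume (Metric.ball (0 : EuclideanSpace ℝ (Fin n)) 1) *
        ENNReal.ofReal ((Real.log (R / r) ^ (n - 1))⁻¹) ≤
      ∫⁻ x, ENNReal.ofReal (gradNorm u x ^ n) := by
  have hn0 : n ≠ 0 := by omega
  have hL : 0 < Real.log (R / r) := Real.log_pos ((one_lt_div hr).2 hrR)
  rcases eq_or_ne (∫⁻ x, ENNReal.ofReal (gradNorm u x ^ n)) ⊤ with htop | hfin
  · rw [htop]; exact le_top
  set A : Set (EuclideanSpace ℝ (Fin n)) := {x | ‖x‖ ∈ Ioo r R} with hA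
  have hms : MeasurableSet A := measurable_norm measurableSet_Ioo
  have hn1 : (1 : ℝ) < n := by exact_mod_cast hn
  have hpq : (n : ℝ).HolderConjugate (n / (n - 1)) := Real.HolderConjugate.conjExponent hn1
  obtain ⟨σ, hσ⟩ : ∃ σ : ℝ,
      σ = n * (volume (Metric.ball (0 : EuclideanSpace ℝ (Fin n)) 1)).toReal := ⟨_, rfl⟩
  have hvol : n * volume (Metric.ball (0 : EuclideanSpace ℝ (Fin n)) 1) = ENNReal.ofReal σ := by
    rw [hσ, ENNReal.ofReal_mul (by positivity), ENNReal.ofReal_natCast,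
      ENNReal.ofReal_toReal (volume_unitBall_ne_top n)]
  have hσpos : 0 < σ := hσ ▸ mul_pos (by positivity)
    (ENNReal.toReal_pos (volume_unitBall_ne_zero n) (volume_unitBall_ne_top n))
  set I := (∫⁻ x, ENNReal.ofReal (gradNorm u x ^ n)).toReal with hI
  have hgm := measurable_gradNorm hu.continuous
  -- Hölder with exponents n and n/(n − 1): the second factor becomes |x|^{-n}, whose integral over
  -- the ring is σ ln(R/r).
  have hholder : ∫⁻ x in A, ENNReal.ofReal (gradNorm u x) * ENNReal.ofReal (‖x‖⁻¹ ^ (n - 1)) ≤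
      ENNReal.ofReal (I ^ (1 / (n : ℝ)) *
        (σ * Real.log (R / r)) ^ (1 / ((n : ℝ) / (n - 1)))) := by
    refine (ENNReal.lintegral_mul_le_Lp_mul_Lq (volume.restrict A) hpq
      (hgm.ennreal_ofReal.aemeasurable) (by fun_prop)).trans ?_
    rw [ENNReal.ofReal_mul (by positivity), ← ENNReal.ofReal_rpow_of_nonneg (by positivity)
      (by positivity), ← ENNReal.ofReal_rpow_of_nonneg (by positivity)
      (div_nonneg zero_le_one (div_nonneg (by positivity) (by linarith)))]
    gcongr
    · rw [hI, ENNReal.ofReal_toReal hfin]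
      refine (setLIntegral_le_lintegral _ _).trans (lintegral_mono fun x => ?_)
      rw [ENNReal.rpow_natCast, ENNReal.ofReal_pow (gradNorm_nonneg u x)]
    · rw [ENNReal.ofReal_mul hσpos.le, ← hvol, ← lintegral_inv_norm_pow hn0 hr hrR.le]
      refine setLIntegral_mono' hms fun x hx => ?_
      have hx0 : 0 < ‖x‖ := hr.trans hx.1
      rw [ENNReal.ofReal_rpow_of_nonneg (by positivity) (div_nonneg (by positivity) (by linarith))]
      refine ENNReal.ofReal_le_ofReal (le_of_eq ?_)
      rw [← Real.rpow_natCast, ← Real.rpow_mul (by positivity), ← Real.rpow_natCast,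
        Nat.cast_sub (by omega), Nat.cast_one, mul_div_cancel₀ _ (by linarith)]
  have hweight : ∀ x ∈ A, radialWeight r x = ‖x‖⁻¹ ^ n := fun x hx => by
    rw [radialWeight, max_eq_left hx.1.le]
  -- An arbitrary a lets one bound serve twice: for a single term of ∇u · x, to get integrability,
  -- and for the whole sum, to bound the flux.
  have hdom : ∀ᵐ x : EuclideanSpace ℝ (Fin n), ∀ a : ℝ, |a| ≤ gradNorm u x * ‖x‖ →
      ENNReal.ofReal (|a| * radialWeight r x) ≤
        A.indicator (fun x => ENNReal.ofReal (gradNorm u x) * ENNReal.ofReal (‖x‖⁻¹ ^ (n - 1))) x := by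
    filter_upwards [ae_norm_ne hn0 r] with x hx a ha
    by_cases hxA : x ∈ A
    · have hx0 : 0 < ‖x‖ := hr.trans hxA.1
      rw [indicator_of_mem hxA, hweight x hxA, ← ENNReal.ofReal_mul (gradNorm_nonneg u x)]
      refine ENNReal.ofReal_le_ofReal ((mul_le_mul_of_nonneg_right ha (by positivity)).trans
        (le_of_eq ?_))
      rw [mul_assoc]
      congr 1
      obtain ⟨k, rfl⟩ := Nat.exists_eq_succ_of_ne_zero hn0
      simp only [Nat.succ_eq_add_one, Nat.add_sub_cancel, inv_pow]
      field_simp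
      ring
    · have hg : gradNorm u x = 0 := by
        refine hu.gradNorm_eq_zero ?_
        rcases lt_or_gt_of_ne hx with h | h
        · exact Or.inl h
        · exact Or.inr (not_lt.1 fun h' => hxA ⟨h, h'⟩)
      rw [hg, zero_mul] at ha
      simp [le_antisymm ha (abs_nonneg a)]
  have hbound : ∀ g : EuclideanSpace ℝ (Fin n) → ℝ, (∀ x, |g x| ≤ gradNorm u x * ‖x‖) →
      ∫⁻ x, ENNReal.ofReal (|g x| * radialWeight r x) ≤ ENNReal.ofReal (I ^ (1 / (n : ℝ)) *
        (σ * Real.log (R / r)) ^ (1 / ((n : ℝ) / (n - 1)))) := fun g hg => by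
    refine le_trans ?_ hholder
    rw [← lintegral_indicator hms]
    refine lintegral_mono_ae ?_
    filter_upwards [hdom] with x hx using hx _ (hg x)
  have hwpos : ∀ x : EuclideanSpace ℝ (Fin n), 0 ≤ radialWeight r x := fun x =>
    pow_nonneg (inv_nonneg.2 (hr.le.trans (le_max_right _ _))) _
  have hint : ∀ i : Fin n, Integrable fun x => lineDeriv ℝ u x (EuclideanSpace.single i 1) *
      (x i * radialWeight r x) := by
    intro i
    refine ⟨((measurable_lineDeriv hu.continuous).mul ((by fun_prop :
      Measurable fun x : EuclideanSpace ℝ (Fin n) => x i).mul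
        (continuous_radialWeight hr).measurable)).aestronglyMeasurable, ?_⟩
    rw [hasFiniteIntegral_iff_norm]
    refine lt_of_le_of_lt ?_ ((hbound (fun x => lineDeriv ℝ u x (EuclideanSpace.single i 1) * x i)
      fun x => ?_).trans_lt ENNReal.ofReal_lt_top)
    · refine lintegral_mono fun x => ENNReal.ofReal_le_ofReal (le_of_eq ?_)
      rw [← mul_assoc, norm_mul, Real.norm_of_nonneg (hwpos x), Real.norm_eq_abs]
    · rw [abs_mul]
      exact mul_le_mul (abs_lineDeriv_le_gradNorm u x i) (by simpa using PiLp.norm_apply_le x i)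
        (abs_nonneg _) (gradNorm_nonneg u x)
  have hflux := integral_grad_mul_radialField hn0 hr hu hint
  rw [← hσ] at hflux
  have hmain : ENNReal.ofReal σ ≤ ENNReal.ofReal (I ^ (1 / (n : ℝ)) *
        (σ * Real.log (R / r)) ^ (1 / ((n : ℝ) / (n - 1)))) := by
    refine le_trans ?_ (hbound (fun x => ∑ i : Fin n,
      lineDeriv ℝ u x (EuclideanSpace.single i 1) * x i) fun x => ?_)
    · refine (ENNReal.ofReal_le_ofReal (hflux.ge.trans (le_abs_self _))).trans ?_
      rw [← Real.norm_eq_abs]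
      refine (ofReal_norm _).le.trans ((enorm_integral_le_lintegral_enorm _).trans
        (lintegral_mono fun x => ?_))
      rw [← ofReal_norm, Real.norm_eq_abs]
      refine ENNReal.ofReal_le_ofReal (le_of_eq ?_)
      simp only [← mul_assoc]
      rw [← Finset.sum_mul, abs_mul, abs_of_nonneg (hwpos x)]
    · have hcs := Finset.sum_mul_sq_le_sq_mul_sq Finset.univ
        (fun i => lineDeriv ℝ u x (EuclideanSpace.single i 1)) (fun i => x i)
      rw [← Real.sqrt_sq_eq_abs, gradNorm, EuclideanSpace.norm_eq, ← Real.sqrt_mul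
        (Finset.sum_nonneg fun i _ => sq_nonneg _)]
      refine Real.sqrt_le_sqrt ?_
      simpa using hcs
  have hI0 : 0 ≤ I := ENNReal.toReal_nonneg
  rw [ENNReal.ofReal_le_ofReal_iff (by positivity)] at hmain
  -- The n-th power of the flux inequality is σ^n ≤ I (σ ln(R/r))^{n-1}; dividing by (σ
  -- ln(R/r))^{n-1} gives the claim.
  have hpow := pow_le_pow_left₀ hσpos.le hmain n
  have e1 : (I ^ (1 / (n : ℝ))) ^ n = I := by
    rw [← Real.rpow_natCast, ← Real.rpow_mul hI0, one_div_mul_cancel (by positivity), Real.rpow_one]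
  have e2 : ((σ * Real.log (R / r)) ^ (1 / ((n : ℝ) / (n - 1)))) ^ n =
      (σ * Real.log (R / r)) ^ (n - 1) := by
    rw [← Real.rpow_natCast, ← Real.rpow_mul (by positivity), ← Real.rpow_natCast _ (n - 1),
      Nat.cast_sub (by omega), Nat.cast_one]
    congr 1
    field_simp
  rw [mul_pow, e1, e2, mul_pow] at hpow
  rw [hvol, ← ENNReal.ofReal_mul hσpos.le, ← ENNReal.ofReal_toReal hfin]
  refine ENNReal.ofReal_le_ofReal ?_
  rw [← div_eq_mul_inv, div_le_iff₀ (by positivity)]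
  have hsplit : σ ^ n = σ * σ ^ (n - 1) := by
    rw [← pow_succ']; congr 1; omega
  rw [hsplit] at hpow
  have h3 : 0 < σ ^ (n - 1) := by positivity
  refine le_of_mul_le_mul_right (a := σ ^ (n - 1)) ?_ h3
  calc _ ≤ _ := hpow
    _ = _ := by ring

end LowerBound

end ConformalCapacity

namespace ConformalCapacity

open Set

/-! ### Extremal functions and the exact capacity of a ring -/

section UpperBound

variable {n : ℕ} {r R S : ℝ}

/-- The extremal function of the spherical ring with radii `r < S`. -/
noncomputable def ringFunction (r S : ℝ) (x : EuclideanSpace ℝ (Fin n)) : ℝ :=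
  min 1 ((Real.log (S / r))⁻¹ * Real.log (max ‖x‖ r / r))

theorem lipschitzWith_log_max_norm (hr : 0 < r) :
    LipschitzWith (Real.toNNReal r⁻¹)
      fun x : EuclideanSpace ℝ (Fin n) => Real.log (max ‖x‖ r / r) := by
  have key : ∀ a b : ℝ, r ≤ a → r ≤ b → Real.log (a / r) - Real.log (b / r) ≤ r⁻¹ * |a - b| := by
    intro a b ha hb
    have ha0 := hr.trans_le ha
    have hb0 := hr.trans_le hb
    rw [← Real.log_div (by positivity) (by positivity), div_div_div_cancel_right₀ hr.ne']
    calc Real.log (a / b) ≤ a / b - 1 := Real.log_le_sub_one_of_pos (by positivity)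
      _ = b⁻¹ * (a - b) := by field_simp
      _ ≤ b⁻¹ * |a - b| := by gcongr; exact le_abs_self _
      _ ≤ _ := by gcongr
  refine LipschitzWith.of_dist_le_mul fun x y => ?_
  have hmax : |max ‖x‖ r - max ‖y‖ r| ≤ dist x y := by
    refine (abs_max_sub_max_le_abs _ _ _).trans ?_
    rw [dist_eq_norm]
    exact abs_norm_sub_norm_le x y
  rw [Real.coe_toNNReal _ (by positivity), Real.dist_eq]
  refine le_trans ?_ (mul_le_mul_of_nonneg_left hmax (by positivity))
  rw [abs_le']
  refine ⟨key _ _ (le_max_right _ _) (le_max_right _ _), ?_⟩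
  rw [neg_sub, abs_sub_comm]
  exact key _ _ (le_max_right _ _) (le_max_right _ _)

theorem lipschitzWith_ringFunction (hr : 0 < r) : ∃ C : NNReal,
    LipschitzWith C (ringFunction r S : EuclideanSpace ℝ (Fin n) → ℝ) :=
  ⟨_, ((LipschitzWith.of_dist_le_mul fun a b => by
    rw [Real.dist_eq, ← mul_sub, abs_mul, Real.dist_eq, coe_nnnorm, Real.norm_eq_abs] :
      LipschitzWith ‖(Real.log (S / r))⁻¹‖₊ fun a : ℝ => (Real.log (S / r))⁻¹ * a).comp
        (lipschitzWith_log_max_norm hr)).const_min 1⟩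

theorem ringFunction_lt_one_iff (hr : 0 < r) (hrS : r < S) {x : EuclideanSpace ℝ (Fin n)} :
    ringFunction r S x < 1 ↔ ‖x‖ < S := by
  have hL : 0 < Real.log (S / r) := Real.log_pos ((one_lt_div hr).2 hrS)
  have hm : 0 < max ‖x‖ r := lt_max_of_lt_right hr
  rw [ringFunction, min_lt_iff]
  simp only [lt_self_iff_false, false_or]
  rw [inv_mul_lt_one₀ hL, Real.log_lt_log_iff (by positivity) (div_pos (hr.trans hrS) hr),
    div_lt_div_iff_of_pos_right hr, max_lt_iff]
  exact and_iff_left hrS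

theorem isAdmissible_ringFunction (hr : 0 < r) (hrS : r < S) (hSR : S < R) :
    IsAdmissible (Metric.ball 0 R) (Metric.closedBall 0 r)
      (ringFunction r S : EuclideanSpace ℝ (Fin n) → ℝ) := by
  obtain ⟨C, hC⟩ := lipschitzWith_ringFunction (n := n) (S := S) hr
  have hL : 0 < Real.log (S / r) := Real.log_pos ((one_lt_div hr).2 hrS)
  have hcl : closure {x : EuclideanSpace ℝ (Fin n) | 0 ≤ ringFunction r S x ∧ ringFunction r S x < 1} ⊆
      Metric.closedBall 0 S :=
    closure_minimal (fun x hx => by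
      simpa using ((ringFunction_lt_one_iff hr hrS).1 hx.2).le) Metric.isClosed_closedBall
  exact
    { continuous := hC.continuous
      acl := fun i => ae_of_all _ fun y a b =>
        ((hC.comp (lipschitzWith_linePoint i y)).lipschitzOnWith).absolutelyContinuousOnInterval
      nonneg := fun x => le_min zero_le_one (mul_nonneg (inv_nonneg.2 hL.le)
        (Real.log_nonneg ((one_le_div hr).2 (le_max_right _ _))))
      le_one := fun x => min_le_left _ _
      eq_zero := fun x hx => by
        have : ‖x‖ ≤ r := by simpa using hx
        simp [ringFunction, max_eq_right this, hr.ne']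
      isCompact_closure := (isCompact_closedBall _ _).of_isClosed_subset isClosed_closure hcl
      closure_subset := hcl.trans (Metric.closedBall_subset_ball hSR) }

theorem gradNorm_ringFunction (hr : 0 < r) (hrS : r < S) {x : EuclideanSpace ℝ (Fin n)}
    (hx : ‖x‖ ∈ Ioo r S) :
    gradNorm (ringFunction r S) x = (Real.log (S / r))⁻¹ * ‖x‖⁻¹ := by
  have hL : 0 < Real.log (S / r) := Real.log_pos ((one_lt_div hr).2 hrS)
  have hx0 : 0 < ‖x‖ := hr.trans hx.1
  have hd : ∀ i : Fin n, lineDeriv ℝ (ringFunction r S) x (EuclideanSpace.single i 1) =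
      (Real.log (S / r))⁻¹ * (x i / ‖x‖ / ‖x‖) := by
    intro i
    have h1 := (((hasDerivAt_norm_line (norm_pos_iff.1 hx0) i).div_const r).log
      (by simpa using ⟨norm_pos_iff.1 hx0, hr.ne'⟩)).const_mul (Real.log (S / r))⁻¹
    have h2 := (h1.congr_of_eventuallyEq (f₁ := fun t : ℝ =>
      ringFunction r S (x + t • EuclideanSpace.single i (1 : ℝ))) ?_).deriv
    · refine h2.trans ?_
      simp only [zero_smul, add_zero]
      field_simp
    · filter_upwards [eventually_norm_line i isOpen_Ioo hx] with t ht
      have h3 := (ringFunction_lt_one_iff (x := x + t • EuclideanSpace.single i (1 : ℝ)) hr hrS).2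
        ht.2
      rw [ringFunction] at h3 ⊢
      rw [min_eq_right ((min_lt_iff.1 h3).resolve_left (lt_irrefl _)).le, max_eq_left ht.1.le]
  have hsum : ∑ i, x i ^ 2 = ‖x‖ ^ 2 := by
    rw [EuclideanSpace.norm_sq_eq]; simp
  rw [gradNorm]
  simp only [hd, mul_pow, div_pow]
  rw [← Finset.mul_sum, ← Finset.sum_div, ← Finset.sum_div, hsum, div_self (by positivity),
    Real.sqrt_eq_iff_mul_self_eq (by positivity) (by positivity)]
  field_simp

theorem lintegral_gradNorm_ringFunction (hn : n ≠ 0) (hr : 0 < r) (hrS : r < S) :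
    ∫⁻ x : EuclideanSpace ℝ (Fin n), ENNReal.ofReal (gradNorm (ringFunction r S) x ^ n) =
      n * volume (Metric.ball (0 : EuclideanSpace ℝ (Fin n)) 1) *
        ENNReal.ofReal ((Real.log (S / r) ^ (n - 1))⁻¹) := by
  have hL : 0 < Real.log (S / r) := Real.log_pos ((one_lt_div hr).2 hrS)
  have hms : MeasurableSet {x : EuclideanSpace ℝ (Fin n) | ‖x‖ ∈ Ioo r S} :=
    measurable_norm measurableSet_Ioo
  calc _ = ∫⁻ x : EuclideanSpace ℝ (Fin n), {x : EuclideanSpace ℝ (Fin n) | ‖x‖ ∈ Ioo r S}.indicator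
        (fun x => ENNReal.ofReal ((Real.log (S / r))⁻¹ ^ n) * ENNReal.ofReal (‖x‖⁻¹ ^ n)) x := by
        refine lintegral_congr_ae ?_
        filter_upwards [ae_norm_ne hn r, ae_norm_ne hn S] with x hxr hxS
        by_cases hx : ‖x‖ ∈ Ioo r S
        · rw [indicator_of_mem (by exact hx), gradNorm_ringFunction hr hrS hx, mul_pow,
            ENNReal.ofReal_mul (by positivity)]
        · have : gradNorm (ringFunction r S) x = 0 := by
            rcases lt_or_gt_of_ne hxr with h | h
            -- Any outer radius beyond S would do; S + 1 only provides an admissible pair.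
            · exact (isAdmissible_ringFunction hr hrS (lt_add_one S)).gradNorm_eq_zero (Or.inl h)
            · have hxS' : S < ‖x‖ := lt_of_le_of_ne (not_lt.1 fun h' => hx ⟨h, h'⟩) hxS.symm
              refine gradNorm_eq_zero_of_eventually_const (c := 1) ?_
              filter_upwards [(isOpen_lt continuous_const continuous_norm).mem_nhds hxS'] with z hz
              refine le_antisymm (min_le_left _ _) (not_lt.1 fun h' => ?_)
              exact absurd ((ringFunction_lt_one_iff hr hrS).1 h') (not_lt.2 (le_of_lt hz))
          rw [indicator_of_notMem (by exact hx), this, zero_pow hn, ENNReal.ofReal_zero]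
    _ = ENNReal.ofReal ((Real.log (S / r))⁻¹ ^ n) *
        (n * volume (Metric.ball (0 : EuclideanSpace ℝ (Fin n)) 1) *
          ENNReal.ofReal (Real.log (S / r))) := by
        rw [lintegral_indicator hms, lintegral_const_mul _ (by fun_prop),
          lintegral_inv_norm_pow hn hr hrS.le]
    _ = _ := by
        rw [mul_left_comm, ← ENNReal.ofReal_mul (by positivity)]
        congr 2
        obtain ⟨k, rfl⟩ := Nat.exists_eq_succ_of_ne_zero hn
        simp only [Nat.succ_eq_add_one, Nat.add_sub_cancel, inv_pow]
        field_simp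
        ring

/-- The extremal function with outer radius R is not itself admissible, since the closure of {u < 1}
would reach |x| = R. The upper bound uses outer radii S < R and continuity as S → R. -/
theorem condCap_ring (hn : 2 ≤ n) (hr : 0 < r) (hrR : r < R) :
    condCap (Metric.ball (0 : EuclideanSpace ℝ (Fin n)) R) (Metric.closedBall 0 r) =
      n * volume (Metric.ball (0 : EuclideanSpace ℝ (Fin n)) 1) *
        ENNReal.ofReal ((Real.log (R / r) ^ (n - 1))⁻¹) := by
  refine le_antisymm ?_ (le_iInf fun u => le_iInf fun hu => hu.le_lintegral_gradNorm hn hr hrR)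
  have hL : 0 < Real.log (R / r) := Real.log_pos ((one_lt_div hr).2 hrR)
  have hcont : ContinuousAt (fun S : ℝ => (Real.log (S / r) ^ (n - 1))⁻¹) R := by
    refine ContinuousAt.inv₀ (ContinuousAt.pow (ContinuousAt.log (by fun_prop) ?_) _)
      (by positivity)
    exact (div_pos (hr.trans hrR) hr).ne'
  have hlim : Tendsto (fun S : ℝ => n * volume (Metric.ball (0 : EuclideanSpace ℝ (Fin n)) 1) *
      ENNReal.ofReal ((Real.log (S / r) ^ (n - 1))⁻¹)) (𝓝[<] R)
      (𝓝 (n * volume (Metric.ball (0 : EuclideanSpace ℝ (Fin n)) 1) *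
        ENNReal.ofReal ((Real.log (R / r) ^ (n - 1))⁻¹))) :=
    ENNReal.Tendsto.const_mul
      (ENNReal.tendsto_ofReal (hcont.tendsto.mono_left nhdsWithin_le_nhds))
      (Or.inr (ENNReal.mul_ne_top (ENNReal.natCast_ne_top n) (volume_unitBall_ne_top n)))
  refine ge_of_tendsto hlim ?_
  filter_upwards [Ioo_mem_nhdsLT hrR] with S hS
  rw [← lintegral_gradNorm_ringFunction (by omega) hr hS.1]
  exact iInf_le_of_le _ (iInf_le _ (isAdmissible_ringFunction hr hS.1 hS.2))

end UpperBound

/-! ### Moduli and capacities of balls -/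

section Modulus

variable {n : ℕ} {r R : ℝ}

theorem sphereArea_pos {k : ℕ} (hk : k ≠ 0) : 0 < sphereArea k := by
  rw [sphereArea, if_neg hk]
  have := Real.Gamma_pos_of_pos (s := ((k : ℝ) + 1) / 2) (by positivity)
  positivity

theorem natCast_mul_volume_unitBall (hn : 2 ≤ n) :
    n * volume (Metric.ball (0 : EuclideanSpace ℝ (Fin n)) 1) =
      ENNReal.ofReal (sphereArea (n - 1)) := by
  have : Nonempty (Fin n) := ⟨⟨0, by omega⟩⟩
  have hn0 : (0 : ℝ) < n := by positivity
  rw [EuclideanSpace.volume_ball, ENNReal.ofReal_one, one_pow, one_mul, Fintype.card_fin,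
    ← ENNReal.ofReal_natCast, ← ENNReal.ofReal_mul (by positivity), sphereArea,
    if_neg (by omega : n - 1 ≠ 0), Nat.cast_sub (by omega), Nat.cast_one, sub_add_cancel,
    Real.Gamma_add_one (by positivity), Real.sqrt_eq_rpow, ← Real.rpow_natCast,
    ← Real.rpow_mul Real.pi_pos.le]
  congr 1
  have hG : Real.Gamma ((n : ℝ) / 2) ≠ 0 := (Real.Gamma_pos_of_pos (by positivity)).ne'
  rw [show 1 / 2 * (n : ℝ) = n / 2 by ring]
  field_simp

theorem nmod_ring (hn : 2 ≤ n) (hr : 0 < r) (hrR : r < R) :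
    nmod (Metric.ball (0 : EuclideanSpace ℝ (Fin n)) R) (Metric.closedBall 0 r) =
      ENNReal.ofReal (Real.log (R / r)) := by
  have hL : 0 < Real.log (R / r) := Real.log_pos ((one_lt_div hr).2 hrR)
  have hσ := sphereArea_pos (k := n - 1) (by omega)
  have hn1 : (1 : ℝ) - n ≠ 0 := by
    have : (2 : ℝ) ≤ n := by exact_mod_cast hn
    linarith
  rw [nmod, condCap_ring hn hr hrR, natCast_mul_volume_unitBall hn, mul_comm,
    ENNReal.mul_div_cancel_right (by simpa using hσ) ENNReal.ofReal_ne_top,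
    ENNReal.ofReal_rpow_of_pos (by positivity)]
  congr 1
  rw [← Real.rpow_natCast, ← Real.rpow_neg hL.le, ← Real.rpow_mul hL.le, Nat.cast_sub (by omega),
    Nat.cast_one, neg_sub, mul_one_div_cancel hn1, Real.rpow_one]

/-- The reduced modulus is already constant once the outer radius exceeds r. -/
theorem tendsto_reducedMod_closedBall (hn : 2 ≤ n) (hr : 0 < r) :
    Tendsto (reducedMod (Metric.closedBall (0 : EuclideanSpace ℝ (Fin n)) r)) atTop
      (𝓝 ((-Real.log r : ℝ) : EReal)) := by
  refine tendsto_const_nhds.congr' ?_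
  filter_upwards [eventually_gt_atTop r] with R hR
  have hL : 0 < Real.log (R / r) := Real.log_pos ((one_lt_div hr).2 hR)
  rw [reducedMod, nmod_ring hn hr hR, EReal.coe_ennreal_ofReal, max_eq_left hL.le,
    ← EReal.coe_sub, Real.log_div (hr.trans hR).ne' hr.ne']
  congr 1
  ring

theorem ncap1_closedBall (hn : 2 ≤ n) (hr : 0 < r) :
    ncap1 (Metric.closedBall (0 : EuclideanSpace ℝ (Fin n)) r) = ENNReal.ofReal r := by
  rw [ncap1, (tendsto_reducedMod_closedBall hn hr).limUnder_eq, ← EReal.coe_neg, neg_neg,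
    EReal.exp_coe, Real.exp_log hr]

/-- For m = 0 the convention σ_0 = 0 does not give the normalizing constant of the angular density,
but the log-sine integral vanishes, so both sides are 0. -/
theorem neg_ballRobin_eq (m : ℕ) :
    -ballRobin m = sphereArea m / (2 * sphereArea (m + 1)) *
      ∫ θ in (0 : ℝ)..Real.pi, Real.sin θ ^ m * Real.log (2 * (1 - Real.cos θ)) := by
  have hJ : logSineIntegral m 1 =
      ∫ θ in (0 : ℝ)..Real.pi, Real.sin θ ^ m * Real.log (2 * (1 - Real.cos θ)) := by
    rw [logSineIntegral]
    congr! 4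
    ring
  rw [ballRobin, neg_neg, ← hJ]
  rcases eq_or_ne m 0 with rfl | hm
  · rw [logSineIntegral_zero (by simp), mul_zero, mul_zero]
  · rw [← sphereArea_div_sphereArea hm]
    congr 1
    ring

theorem ballRobin_eq_zero_iff (m : ℕ) : ballRobin m = 0 ↔ m = 0 := by
  constructor
  · intro h
    by_contra hm
    have := mul_pos (half_pos (sinPowConst_pos m)) (logSineIntegral_one_pos hm)
    rw [ballRobin] at h
    linarith
  · rintro rfl
    rw [ballRobin, logSineIntegral_zero (by simp), mul_zero, neg_zero]

end Modulus

end ConformalCapacity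

/-! ### The theorem, assembled with n = m + 2 -/

theorem theorem2p2 (n : ℕ) (hn : 2 ≤ n) :
    (∀ K : Set (EuclideanSpace ℝ (Fin n)), IsCompact K →
      ∃ L : EReal,
        Tendsto (fun r : ℝ =>
          ConformalCapacity.nmd (Metric.ball (0 : EuclideanSpace ℝ (Fin n)) r) K
            - (Real.log r : EReal)) atTop (𝓝 L) ∧
        ConformalCapacity.ncap3 K =
          EReal.exp (-L) /
            ConformalCapacity.ncap3 (Metric.closedBall (0 : EuclideanSpace ℝ (Fin n)) 1)) ∧
    (∀ r : ℝ, 0 < r →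
      (∃ L : EReal, Tendsto (ConformalCapacity.reducedMod
        (Metric.closedBall (0 : EuclideanSpace ℝ (Fin n)) r)) atTop (𝓝 L)) ∧
      ConformalCapacity.ncap1 (Metric.closedBall (0 : EuclideanSpace ℝ (Fin n)) r) =
        ENNReal.ofReal r ∧
      ConformalCapacity.ncap3 (Metric.closedBall (0 : EuclideanSpace ℝ (Fin n)) r) =
        ENNReal.ofReal (r * Real.exp
          (ConformalCapacity.sphereArea (n - 2) / (2 * ConformalCapacity.sphereArea (n - 1)) *
            ∫ θ in (0 : ℝ)..Real.pi,
              Real.sin θ ^ (n - 2) * Real.log (2 * (1 - Real.cos θ)))) ∧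
      (ConformalCapacity.ncap1 (Metric.closedBall (0 : EuclideanSpace ℝ (Fin n)) r) =
        ConformalCapacity.ncap3 (Metric.closedBall (0 : EuclideanSpace ℝ (Fin n)) r) ↔
          n = 2)) := by
  obtain ⟨m, rfl⟩ : ∃ m, n = m + 2 := ⟨n - 2, by omega⟩
  refine ⟨fun K hK => ⟨_, ConformalCapacity.tendsto_nmd_sub_log hK,
    ConformalCapacity.ncap3_eq_exp_div K⟩, fun r hr => ⟨⟨_,
    ConformalCapacity.tendsto_reducedMod_closedBall hn hr⟩,
    ConformalCapacity.ncap1_closedBall hn hr, ?_, ?_⟩⟩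
  · rw [ConformalCapacity.ncap3_closedBall m hr, ConformalCapacity.neg_ballRobin_eq]
    rfl
  · rw [ConformalCapacity.ncap1_closedBall hn hr, ConformalCapacity.ncap3_closedBall m hr,
      ENNReal.ofReal_eq_ofReal_iff hr.le (by positivity), left_eq_mul₀ hr.ne', Real.exp_eq_one_iff,
      neg_eq_zero, ConformalCapacity.ballRobin_eq_zero_iff]
    omega
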